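/- **Setting.** Let $I=(0,1]$ and let $P,E,F$ be finite dimensional real vector spaces. A net $(u_\varepsilon)_{\varepsilon\in I}$ of smooth maps $P\times E\to F$ whose derivatives are, for every fixed $\varepsilon$, polynomially bounded in $y\in E$, uniformly for $s$ in compact subsets of $P$, is called *moderate* if for all compact $K\subset P$ and all $k\in\mathbb N_0$ there is $m\in\mathbb N_0$ with $\sup_{s\in K,\,y\in E}(1+|y|)^{-m}\|D^ku_\varepsilon(s,y)\|=O(\varepsilon^{-m})$ as $\varepsilon\to0$, and *negligible* if for all $K,k$ there is $m$ such that for all $r\in\mathbb N_0$ this supremum is $O(\varepsilon^{r})$. Let $\widetilde{\mathcal G}_\tau(P\times E;F)$ be the quotient of the moderate by the negligible nets, $\mathcal G_\tau(E;F)=\widetilde{\mathcal G}_\tau(\mathbb R^0\times E;F)$, $\mathcal G(P;F)=\widetilde{\mathcal G}_\tau(P\times\mathbb R^0;F)$, and let $\widetilde F=\mathcal G(\mathbb R^0;F)$ be the generalized points of $F$; we omit $F$ if $F=\mathbb R$. Derivatives, products, compositions and point values are formed componentwise on representatives. A *generalized group action* on $E$ is $\Phi\in\widetilde{\mathcal G}_\tau(\mathbb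 R\times E;E)$ with $\Phi(0,\cdot)=\mathrm{id}$ in $\mathcal G_\tau(E;E)$ and $\Phi(\eta_1+\eta_2,\cdot)=\Phi(\eta_1,\Phi(\eta_2,\cdot))$ in $\widetilde{\mathcal G}_\tau(\mathbb R^2\times E;E)$. A generalized vector field $\xi\in\mathcal G_\tau(E;E)$ is *$\mathcal G$-complete* if for all $t_0\in\mathbb R$ and $\tilde x_0\in\widetilde E$ the problem $\dot x=\xi(x)$, $x(t_0)=\tilde x_0$ has exactly one solution $x\in\mathcal G(\mathbb R;E)$. The vector field generated by $\Phi$ is $\frac{d}{d\eta}\big|_{0}\Phi(\eta,\cdot)$. Let $p,q,n\in\mathbb N_0$ and let $\Phi(\eta,(x,u))=(\Xi_\eta(x),\Psi_\eta(x,u))$ be a projectable generalized group action on $\mathbb R^p\times\mathbb R^q$, where $\Xi\in\widetilde{\mathcal G}_\tau(\mathbb R\times\mathbb R^p;\mathbb R^p)$ and $\Psi\in\widetilde{\mathcal G}_\tau(\mathbb R\times\mathbb R^{p+q};\mathbb R^q)$. On the $n$-jet space $(\mathbb R^p\times\mathbb R^q)^{(n)}$, with coordinates $z=(x,u^{(n)})=(x_i,u^\alpha_J)$,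 $|J|\le n$, $J$ running over unordered tuples of indices in $\{1,\dots,p\}$, the prolonged action is $$\mathrm{pr}^{(n)}\Phi(\eta,z)=\bigl(\Xi_\eta(x),\ \mathrm{pr}^{(n)}(\Phi_\eta(h_z))(\Xi_\eta(x))\bigr),\qquad \Phi_\eta(h)(y)=\Psi_\eta(\Xi_{-\eta}(y),h(\Xi_{-\eta}(y))),$$ where $h_z$ is the Taylor polynomial of degree at most $n$ whose $n$-jet at $x$ is $z$. Let $$X=\sum_{i=1}^p\xi_i(x)\,\partial_{x_i}+\sum_{\alpha=1}^q\psi_\alpha(x,u)\,\partial_{u^\alpha},\qquad \xi_i\in\mathcal G_\tau(\mathbb R^p),\ \psi_\alpha\in\mathcal G_\tau(\mathbb R^{p+q}),$$ be *$\mathcal G$-$n$-complete* with corresponding action $\Phi$: $\Phi$ generates $X$, $X$ is $\mathcal G$-complete, and $\mathrm{pr}^{(n)}X:=\frac{d}{d\eta}\big|_{0}\mathrm{pr}^{(n)}\Phi(\eta,\cdot)$ is $\mathcal G$-complete. **Theorem.** Under these assumptions $$\mathrm{pr}^{(n)}X=X+\sum_{\alpha=1}^q\ \sum_{1\le|J|\le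 n}\psi_\alpha^J(x,u^{(n)})\,\partial_{u_J^\alpha}$$ with coefficients $\psi^J_\alpha\in\mathcal G_\tau((\mathbb R^p\times\mathbb R^q)^{(n)})$ which, for every tuple $J=(j_1,\dots,j_k)$, $1\le k\le n$, $1\le j_1,\dots,j_k\le p$, are given by $$\psi_\alpha^J=D_J\Bigl(\psi_\alpha-\sum_{i=1}^p\xi_iu_i^\alpha\Bigr)+\sum_{i=1}^p\xi_iu_{J,i}^\alpha ,$$ an equality in $\mathcal G_\tau$ of the $(n+1)$-jet space, where $D_J=D_{j_1}\cdots D_{j_k}$ and $D_if=\partial_{x_i}f+\sum_{\beta}\sum_{|K|\le m}u^\beta_{K,i}\,\partial_{u^\beta_K}f$ for a generalized function $f$ of $m$-jets. -/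

import Mathlib

open Filter Topology
open scoped ContDiff

set_option linter.unusedSectionVars false

noncomputable section

namespace Colombeau

/-- The index set `I = (0,1]` of the regularization parameter. -/
abbrev Eps : Type := Set.Ioc (0 : ℝ) 1

/-- The filter `ε → 0` on `I = (0,1]`. -/
def epsZero : Filter Eps := comap (fun ε : Eps => (ε : ℝ)) (𝓝 0)

section Nets

variable {P E F : Type} [NormedAddCommGroup P] [NormedSpace ℝ P]
  [NormedAddCommGroup E] [NormedSpace ℝ E] [NormedAddCommGroup F] [NormedSpace ℝ F]

/-- Smooth functions on `P × E` all of whose derivatives grow at most polynomially in the second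
variable, uniformly for the first variable in compact sets.  For `P = ℝ⁰` this is the space
`𝒪_M(E)` of slowly increasing functions, for `E = ℝ⁰` it is the space of smooth functions on
`P` (on a finite dimensional `P`, the only case used). -/
def SlowlyIncreasing (f : P × E → F) : Prop :=
  ContDiff ℝ ∞ f ∧ ∀ K : Set P, IsCompact K → ∀ k : ℕ, ∃ (m : ℕ) (C : ℝ), ∀ s ∈ K, ∀ y : E,
    ‖iteratedFDeriv ℝ k f (s, y)‖ ≤ C * (1 + ‖y‖) ^ m

/-- Moderate nets: `𝓖`-bounds in the variable of `P`, `𝓖_τ`-bounds in the variable of `E`. -/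
def IsModerate (u : Eps → P × E → F) : Prop :=
  (∀ ε, SlowlyIncreasing (u ε)) ∧ ∀ K : Set P, IsCompact K → ∀ k : ℕ, ∃ (m : ℕ) (C : ℝ),
    ∀ᶠ ε : Eps in epsZero, ∀ s ∈ K, ∀ y : E,
      ‖iteratedFDeriv ℝ k (u ε) (s, y)‖ ≤ C * (ε : ℝ)⁻¹ ^ m * (1 + ‖y‖) ^ m

/-- Negligible nets. -/
def IsNegligible (u : Eps → P × E → F) : Prop :=
  (∀ ε, SlowlyIncreasing (u ε)) ∧ ∀ K : Set P, IsCompact K → ∀ k : ℕ, ∃ m : ℕ, ∀ r : ℕ, ∃ C : ℝ,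
    ∀ᶠ ε : Eps in epsZero, ∀ s ∈ K, ∀ y : E,
      ‖iteratedFDeriv ℝ k (u ε) (s, y)‖ ≤ C * (ε : ℝ) ^ r * (1 + ‖y‖) ^ m

/-- Auxiliary: polynomially bounded families of numbers, relative to a filter on `I`. -/
def Bd (l : Filter Eps) (K : Set P) (a : Eps → P × E → ℝ) : Prop :=
  ∃ (m : ℕ) (C : ℝ), 0 ≤ C ∧ ∀ᶠ ε : Eps in l, ∀ s ∈ K, ∀ y : E,
    |a ε (s, y)| ≤ C * ((ε : ℝ)⁻¹ ^ m * (1 + ‖y‖) ^ m)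

/-- Auxiliary: negligible families of numbers. -/
def Ng (K : Set P) (a : Eps → P × E → ℝ) : Prop :=
  ∃ b : Eps → P × E → ℝ, Bd epsZero K b ∧ ∀ r : ℕ, ∃ C : ℝ, 0 ≤ C ∧
    ∀ᶠ ε : Eps in epsZero, ∀ s ∈ K, ∀ y : E, |a ε (s, y)| ≤ C * (ε : ℝ) ^ r * |b ε (s, y)|

theorem one_le_inv_eps (ε : Eps) : 1 ≤ (ε : ℝ)⁻¹ := (one_le_inv₀ ε.2.1).2 ε.2.2

theorem wt_mono (ε : Eps) (y : E) {m m' : ℕ} (h : m ≤ m') :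
    (ε : ℝ)⁻¹ ^ m * (1 + ‖y‖) ^ m ≤ (ε : ℝ)⁻¹ ^ m' * (1 + ‖y‖) ^ m' := by
  have h1 := one_le_inv_eps ε
  have h2 : 1 ≤ 1 + ‖y‖ := by linarith [norm_nonneg y]
  have := pow_le_pow_right₀ h1 h
  have := pow_le_pow_right₀ h2 h
  gcongr

theorem wt_nonneg (ε : Eps) (y : E) (m : ℕ) : 0 ≤ (ε : ℝ)⁻¹ ^ m * (1 + ‖y‖) ^ m := by
  have := ε.2.1
  positivity

variable {l : Filter Eps} {K : Set P} {a b : Eps → P × E → ℝ}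

theorem Bd.mono (hb : Bd l K b) (h : ∀ ε, ∀ s ∈ K, ∀ y, |a ε (s, y)| ≤ |b ε (s, y)|) :
    Bd l K a := by
  obtain ⟨m, C, hC, H⟩ := hb
  exact ⟨m, C, hC, H.mono fun ε hε s hs y => (h ε s hs y).trans (hε s hs y)⟩

theorem Bd.add (ha : Bd l K a) (hb : Bd l K b) : Bd l K (fun ε x => a ε x + b ε x) := by
  obtain ⟨m, C, hC, H⟩ := ha
  obtain ⟨m', C', hC', H'⟩ := hb
  refine ⟨m + m', C + C', by positivity, ?_⟩
  filter_upwards [H, H'] with ε h h' s hs y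
  have h1 := mul_le_mul_of_nonneg_left (wt_mono ε y (Nat.le_add_right m m')) hC
  have h2 := mul_le_mul_of_nonneg_left (wt_mono ε y (Nat.le_add_left m' m)) hC'
  have := abs_add_le (a ε (s, y)) (b ε (s, y))
  have := h s hs y
  have := h' s hs y
  rw [add_mul]
  linarith

theorem Bd.mul (ha : Bd l K a) (hb : Bd l K b) : Bd l K (fun ε x => a ε x * b ε x) := by
  obtain ⟨m, C, hC, H⟩ := ha
  obtain ⟨m', C', hC', H'⟩ := hb
  refine ⟨m + m', C * C', by positivity, ?_⟩
  filter_upwards [H, H'] with ε h h' s hs y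
  rw [abs_mul]
  calc _ ≤ (C * ((ε : ℝ)⁻¹ ^ m * (1 + ‖y‖) ^ m)) * (C' * ((ε : ℝ)⁻¹ ^ m' * (1 + ‖y‖) ^ m')) :=
        mul_le_mul (h s hs y) (h' s hs y) (abs_nonneg _) (mul_nonneg hC (wt_nonneg ε y m))
    _ = _ := by ring

theorem Bd.const (c : ℝ) : Bd l K (fun _ (_ : P × E) => c) :=
  ⟨0, |c|, abs_nonneg c, Eventually.of_forall fun ε s _ y => by simp⟩

theorem Bd.pow (ha : Bd l K a) (n : ℕ) : Bd l K (fun ε x => a ε x ^ n) := by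
  induction n with
  | zero => simpa using Bd.const 1
  | succ n ih => simpa [pow_succ] using ih.mul ha

theorem Bd.sum {ι : Type} (t : Finset ι) {a : ι → Eps → P × E → ℝ} (h : ∀ i ∈ t, Bd l K (a i)) :
    Bd l K (fun ε x => ∑ i ∈ t, a i ε x) := by
  classical
  induction t using Finset.induction_on with
  | empty => simpa using Bd.const 0
  | insert i t hi ih =>
    simp only [Finset.sum_insert hi]
    exact (h i (Finset.mem_insert_self _ _)).add (ih fun j hj => h j (Finset.mem_insert_of_mem hj))

theorem Ng.mono (hb : Ng K b) (h : ∀ ε, ∀ s ∈ K, ∀ y, |a ε (s, y)| ≤ |b ε (s, y)|) :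
    Ng K a := by
  obtain ⟨c, hc, H⟩ := hb
  refine ⟨c, hc, fun r => ?_⟩
  obtain ⟨C, hC, H⟩ := H r
  exact ⟨C, hC, H.mono fun ε hε s hs y => (h ε s hs y).trans (hε s hs y)⟩

theorem Ng.mul (ha : Ng K a) (hb : Bd epsZero K b) : Ng K (fun ε x => a ε x * b ε x) := by
  obtain ⟨c, hc, H⟩ := ha
  refine ⟨_, hc.mul hb, fun r => ?_⟩
  obtain ⟨C, hC, H⟩ := H r
  refine ⟨C, hC, H.mono fun ε hε s hs y => ?_⟩
  rw [abs_mul, abs_mul, ← mul_assoc]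
  exact mul_le_mul_of_nonneg_right (hε s hs y) (abs_nonneg _)

theorem Ng.add (ha : Ng K a) (hb : Ng K b) : Ng K (fun ε x => a ε x + b ε x) := by
  obtain ⟨c, hc, H⟩ := ha
  obtain ⟨d, hd, H'⟩ := hb
  have hc' : Bd epsZero K (fun ε x => |c ε x|) := hc.mono (by simp)
  have hd' : Bd epsZero K (fun ε x => |d ε x|) := hd.mono (by simp)
  refine ⟨_, hc'.add hd', fun r => ?_⟩
  obtain ⟨C, hC, H⟩ := H r
  obtain ⟨C', hC', H'⟩ := H' r
  refine ⟨C + C', by positivity, ?_⟩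
  filter_upwards [H, H'] with ε h h' s hs y
  have hε := ε.2.1
  have h1 := h s hs y
  have h2 := h' s hs y
  have h3 := abs_add_le (a ε (s, y)) (b ε (s, y))
  rw [abs_of_nonneg (by positivity : 0 ≤ |c ε (s, y)| + |d ε (s, y)|)]
  have h4 : 0 ≤ C * (ε : ℝ) ^ r * |d ε (s, y)| := by positivity
  have h5 : 0 ≤ C' * (ε : ℝ) ^ r * |c ε (s, y)| := by positivity
  nlinarith

theorem Ng.zero : Ng K (fun _ (_ : P × E) => (0 : ℝ)) :=
  ⟨_, Bd.const 0, fun _ => ⟨0, le_rfl, by simp⟩⟩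

theorem Ng.sum {ι : Type} (t : Finset ι) {a : ι → Eps → P × E → ℝ} (h : ∀ i ∈ t, Ng K (a i)) :
    Ng K (fun ε x => ∑ i ∈ t, a i ε x) := by
  classical
  induction t using Finset.induction_on with
  | empty => simpa using Ng.zero
  | insert i t hi ih =>
    simp only [Finset.sum_insert hi]
    exact (h i (Finset.mem_insert_self _ _)).add (ih fun j hj => h j (Finset.mem_insert_of_mem hj))

theorem slowlyIncreasing_iff {f : P × E → F} (ε₀ : Eps) :
    SlowlyIncreasing f ↔ ContDiff ℝ ∞ f ∧ ∀ K : Set P, IsCompact K → ∀ k : ℕ,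
      Bd (pure ε₀) K (fun _ x => ‖iteratedFDeriv ℝ k f x‖) := by
  refine and_congr_right fun _ => forall_congr' fun K => forall_congr' fun _ =>
    forall_congr' fun k => ⟨?_, ?_⟩
  · rintro ⟨m, C, H⟩
    refine ⟨m, |C|, abs_nonneg C, ?_⟩
    refine eventually_pure.2 fun s hs y => ?_
    rw [abs_norm]
    have h1 := one_le_pow₀ (one_le_inv_eps ε₀) (n := m)
    calc _ ≤ C * (1 + ‖y‖) ^ m := H s hs y
      _ ≤ |C| * (1 * (1 + ‖y‖) ^ m) := by
        rw [one_mul]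
        exact mul_le_mul_of_nonneg_right (le_abs_self C) (by positivity)
      _ ≤ _ := by gcongr
  · rintro ⟨m, C, hC, H⟩
    rw [eventually_pure] at H
    refine ⟨m, C * (ε₀ : ℝ)⁻¹ ^ m, fun s hs y => ?_⟩
    have := H s hs y
    rwa [abs_norm, ← mul_assoc] at this

theorem isModerate_iff {u : Eps → P × E → F} :
    IsModerate u ↔ (∀ ε, SlowlyIncreasing (u ε)) ∧ ∀ K : Set P, IsCompact K → ∀ k : ℕ,
      Bd epsZero K (fun ε x => ‖iteratedFDeriv ℝ k (u ε) x‖) := by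
  refine and_congr_right fun _ => forall_congr' fun K => forall_congr' fun _ =>
    forall_congr' fun k => ⟨?_, ?_⟩
  · rintro ⟨m, C, H⟩
    refine ⟨m, |C|, abs_nonneg C, H.mono fun ε h s hs y => ?_⟩
    rw [abs_norm, ← mul_assoc]
    have hε := ε.2.1
    refine (h s hs y).trans ?_
    gcongr
    exact le_abs_self C
  · rintro ⟨m, C, hC, H⟩
    refine ⟨m, C, H.mono fun ε h s hs y => ?_⟩
    have := h s hs y
    rwa [abs_norm, ← mul_assoc] at this

theorem isNegligible_iff {u : Eps → P × E → F} :
    IsNegligible u ↔ (∀ ε, SlowlyIncreasing (u ε)) ∧ ∀ K : Set P, IsCompact K → ∀ k : ℕ,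
      Ng K (fun ε x => ‖iteratedFDeriv ℝ k (u ε) x‖) := by
  refine and_congr_right fun _ => forall_congr' fun K => forall_congr' fun _ =>
    forall_congr' fun k => ⟨?_, ?_⟩
  · rintro ⟨m, H⟩
    refine ⟨fun _ x => (1 + ‖x.2‖) ^ m, ⟨m, 1, zero_le_one, ?_⟩, fun r => ?_⟩
    · refine Eventually.of_forall fun ε s _ y => ?_
      have h1 := one_le_pow₀ (one_le_inv_eps ε) (n := m)
      have h2 : 0 ≤ (1 + ‖y‖) ^ m := by positivity
      rw [abs_of_nonneg h2, one_mul]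
      nlinarith
    · obtain ⟨C, H⟩ := H r
      refine ⟨|C|, abs_nonneg C, H.mono fun ε h s hs y => ?_⟩
      have hε := ε.2.1
      rw [abs_norm, abs_of_nonneg (by positivity : (0 : ℝ) ≤ (1 + ‖y‖) ^ m)]
      refine (h s hs y).trans ?_
      gcongr
      exact le_abs_self C
  · rintro ⟨b, ⟨m, C, hC, Hb⟩, H⟩
    refine ⟨m, fun r => ?_⟩
    obtain ⟨C', hC', H⟩ := H (r + m)
    refine ⟨C' * C, ?_⟩
    filter_upwards [H, Hb] with ε h hb s hs y
    have hε := ε.2.1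
    have h1 := h s hs y
    rw [abs_norm] at h1
    refine h1.trans ?_
    calc _ ≤ C' * (ε : ℝ) ^ (r + m) * (C * ((ε : ℝ)⁻¹ ^ m * (1 + ‖y‖) ^ m)) := by
          gcongr
          exact hb s hs y
      _ = C' * C * (ε : ℝ) ^ r * (1 + ‖y‖) ^ m * ((ε : ℝ) * (ε : ℝ)⁻¹) ^ m := by
          rw [mul_pow, pow_add]; ring
      _ = _ := by rw [mul_inv_cancel₀ hε.ne', one_pow, mul_one]

theorem Ng.bd (ha : Ng K a) : Bd epsZero K a := by
  obtain ⟨b, ⟨m, C, hC, hb⟩, H⟩ := ha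
  obtain ⟨C', hC', H⟩ := H 0
  refine ⟨m, C' * C, by positivity, ?_⟩
  filter_upwards [H, hb] with ε h hb s hs y
  have h1 := h s hs y
  have h2 := mul_le_mul_of_nonneg_left (hb s hs y) hC'
  rw [pow_zero, mul_one] at h1
  rw [mul_assoc]
  exact h1.trans h2

theorem IsNegligible.isModerate {u : Eps → P × E → F} (h : IsNegligible u) : IsModerate u :=
  isModerate_iff.2 ⟨h.1, fun K hK k => ((isNegligible_iff.1 h).2 K hK k).bd⟩

theorem SlowlyIncreasing.add {f g : P × E → F} (hf : SlowlyIncreasing f)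
    (hg : SlowlyIncreasing g) : SlowlyIncreasing (f + g) := by
  have ε₀ : Eps := ⟨1, one_pos, le_rfl⟩
  have hf' := (slowlyIncreasing_iff ε₀).1 hf
  have hg' := (slowlyIncreasing_iff ε₀).1 hg
  refine (slowlyIncreasing_iff ε₀).2 ⟨hf.1.add hg.1, fun K hK k =>
    ((hf'.2 K hK k).add (hg'.2 K hK k)).mono fun ε s hs y => ?_⟩
  rw [iteratedFDeriv_add_apply (hf.1.of_le (mod_cast le_top)).contDiffAt
    (hg.1.of_le (mod_cast le_top)).contDiffAt, abs_norm]
  exact (norm_add_le _ _).trans (le_abs_self _)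

theorem SlowlyIncreasing.neg {f : P × E → F} (hf : SlowlyIncreasing f) :
    SlowlyIncreasing (-f) := by
  refine ⟨hf.1.neg, fun K hK k => ?_⟩
  simpa only [iteratedFDeriv_neg_apply, norm_neg] using hf.2 K hK k

theorem SlowlyIncreasing.zero : SlowlyIncreasing (0 : P × E → F) :=
  ⟨contDiff_const, fun K _ k => ⟨0, 0, fun s _ y => by
    rw [show (0 : P × E → F) = fun _ => 0 from rfl, iteratedFDeriv_fun_zero]; simp⟩⟩

theorem IsModerate.add {u v : Eps → P × E → F} (hu : IsModerate u) (hv : IsModerate v) :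
    IsModerate (u + v) := by
  refine isModerate_iff.2 ⟨fun ε => (hu.1 ε).add (hv.1 ε), fun K hK k =>
    (((isModerate_iff.1 hu).2 K hK k).add ((isModerate_iff.1 hv).2 K hK k)).mono
      fun ε s hs y => ?_⟩
  rw [Pi.add_apply, iteratedFDeriv_add_apply ((hu.1 ε).1.of_le (mod_cast le_top)).contDiffAt
    ((hv.1 ε).1.of_le (mod_cast le_top)).contDiffAt, abs_norm]
  exact (norm_add_le _ _).trans (le_abs_self _)

theorem IsNegligible.add {u v : Eps → P × E → F} (hu : IsNegligible u) (hv : IsNegligible v) :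
    IsNegligible (u + v) := by
  refine isNegligible_iff.2 ⟨fun ε => (hu.1 ε).add (hv.1 ε), fun K hK k =>
    (((isNegligible_iff.1 hu).2 K hK k).add ((isNegligible_iff.1 hv).2 K hK k)).mono
      fun ε s hs y => ?_⟩
  rw [Pi.add_apply, iteratedFDeriv_add_apply ((hu.1 ε).1.of_le (mod_cast le_top)).contDiffAt
    ((hv.1 ε).1.of_le (mod_cast le_top)).contDiffAt, abs_norm]
  exact (norm_add_le _ _).trans (le_abs_self _)

theorem IsModerate.neg {u : Eps → P × E → F} (hu : IsModerate u) : IsModerate (-u) := by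
  refine ⟨fun ε => (hu.1 ε).neg, fun K hK k => ?_⟩
  simpa only [Pi.neg_apply, iteratedFDeriv_neg_apply, norm_neg] using hu.2 K hK k

theorem IsNegligible.neg {u : Eps → P × E → F} (hu : IsNegligible u) : IsNegligible (-u) := by
  refine ⟨fun ε => (hu.1 ε).neg, fun K hK k => ?_⟩
  simpa only [Pi.neg_apply, iteratedFDeriv_neg_apply, norm_neg] using hu.2 K hK k

theorem IsNegligible.zero : IsNegligible (0 : Eps → P × E → F) := by
  refine isNegligible_iff.2 ⟨fun _ => .zero, fun K hK k => Ng.zero.mono fun ε s hs y => ?_⟩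
  rw [Pi.zero_apply, show (0 : P × E → F) = fun _ => 0 from rfl, iteratedFDeriv_fun_zero]
  simp

end Nets

section Composition

variable {P E P' E' F : Type} [NormedAddCommGroup P] [NormedSpace ℝ P]
  [NormedAddCommGroup E] [NormedSpace ℝ E] [NormedAddCommGroup P'] [NormedSpace ℝ P']
  [NormedAddCommGroup E'] [NormedSpace ℝ E'] [NormedAddCommGroup F] [NormedSpace ℝ F]

/-- The net `(s, y) ↦ u_ε(h(s), v_ε(s, y))`. -/
def compNet (h : P' → P) (u : Eps → P × E → F) (v : Eps → P' × E' → E) : Eps → P' × E' → F :=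
  fun ε x => u ε (h x.1, v ε x)

theorem Ng.mono' {K : Set P} {a b : Eps → P × E → ℝ} (hb : Ng K b)
    (h : ∀ᶠ ε in epsZero, ∀ s ∈ K, ∀ y, |a ε (s, y)| ≤ |b ε (s, y)|) : Ng K a := by
  obtain ⟨c, hc, H⟩ := hb
  refine ⟨c, hc, fun r => ?_⟩
  obtain ⟨C, hC, H⟩ := H r
  refine ⟨C, hC, ?_⟩
  filter_upwards [H, h] with ε hε h s hs y
  exact (h s hs y).trans (hε s hs y)

theorem Bd.subst {l : Filter Eps} {h : P' → P} {K : Set P'} {a : Eps → P × E → ℝ}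
    {v : Eps → P' × E' → E} (ha : Bd l (h '' K) a) (hv : Bd l K (fun ε x => ‖v ε x‖)) :
    Bd l K (fun ε x => a ε (h x.1, v ε x)) := by
  obtain ⟨m, C, hC, H⟩ := ha
  obtain ⟨m', C', hC', H'⟩ := ((Bd.const (l := l) (K := K) 1).add hv).pow m
  refine ⟨m + m', C * C', by positivity, ?_⟩
  filter_upwards [H, H'] with ε h1 h2 s hs y
  have hε := ε.2.1
  have hε' : 0 ≤ (ε : ℝ)⁻¹ := by positivity
  have h3 := h2 s hs y
  rw [abs_of_nonneg (by positivity)] at h3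
  have h4 : (1 : ℝ) ≤ (1 + ‖y‖) ^ m := one_le_pow₀ (by linarith [norm_nonneg y])
  calc _ ≤ C * ((ε : ℝ)⁻¹ ^ m * (1 + ‖v ε (s, y)‖) ^ m) := h1 _ ⟨s, hs, rfl⟩ _
    _ ≤ C * ((ε : ℝ)⁻¹ ^ m * (C' * ((ε : ℝ)⁻¹ ^ m' * (1 + ‖y‖) ^ m'))) := by gcongr
    _ = C * C' * (((ε : ℝ)⁻¹ ^ (m + m') * (1 * (1 + ‖y‖) ^ m'))) := by rw [pow_add]; ring
    _ ≤ C * C' * (((ε : ℝ)⁻¹ ^ (m + m') * ((1 + ‖y‖) ^ m * (1 + ‖y‖) ^ m'))) := by gcongr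
    _ = _ := by rw [← pow_add (1 + ‖y‖)]

theorem Ng.subst {h : P' → P} {K : Set P'} {a : Eps → P × E → ℝ}
    {v : Eps → P' × E' → E} (ha : Ng (h '' K) a) (hv : Bd epsZero K (fun ε x => ‖v ε x‖)) :
    Ng K (fun ε x => a ε (h x.1, v ε x)) := by
  obtain ⟨b, hb, H⟩ := ha
  refine ⟨_, hb.subst hv, fun r => ?_⟩
  obtain ⟨C, hC, H⟩ := H r
  exact ⟨C, hC, H.mono fun ε h1 s hs y => h1 _ ⟨s, hs, rfl⟩ _⟩

theorem bd_fst (l : Filter Eps) {h : P' → P} (hh : ContDiff ℝ ∞ h) {K : Set P'}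
    (hK : IsCompact K) (k : ℕ) :
    Bd l K (fun _ (x : P' × E') => ‖iteratedFDeriv ℝ k (fun x : P' × E' => h x.1) x‖) := by
  obtain ⟨C, hC⟩ := hK.exists_bound_of_continuousOn
    ((hh.continuous_iteratedFDeriv (m := k) (mod_cast le_top)).continuousOn)
  refine (Bd.const (C * ∏ _i : Fin k, ‖ContinuousLinearMap.fst ℝ P' E'‖)).mono
    fun ε s hs y => ?_
  have := ContinuousLinearMap.iteratedFDeriv_comp_right (ContinuousLinearMap.fst ℝ P' E') hh
    (s, y) (i := k) (mod_cast le_top)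
  have h2 : (fun x : P' × E' => h x.1) = h ∘ (ContinuousLinearMap.fst ℝ P' E') := rfl
  rw [h2, this, abs_norm]
  refine (ContinuousMultilinearMap.norm_compContinuousLinearMap_le _ _).trans
    (le_trans ?_ (le_abs_self _))
  gcongr
  exact hC s hs

theorem bd_pair (l : Filter Eps) {h : P' → P} (hh : ContDiff ℝ ∞ h) {K : Set P'}
    (hK : IsCompact K) {v : Eps → P' × E' → E} (hv : ∀ ε, ContDiff ℝ ∞ (v ε))
    (hb : ∀ k, Bd l K (fun ε x => ‖iteratedFDeriv ℝ k (v ε) x‖)) (k : ℕ) :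
    Bd l K (fun ε (x : P' × E') =>
      ‖iteratedFDeriv ℝ k (fun x : P' × E' => (h x.1, v ε x)) x‖) := by
  refine (((Bd.const ‖ContinuousLinearMap.inl ℝ P E‖).mul (bd_fst l hh hK k)).add
    ((Bd.const ‖ContinuousLinearMap.inr ℝ P E‖).mul (hb k))).mono fun ε s hs y => ?_
  have e : (fun x : P' × E' => (h x.1, v ε x)) =
      (ContinuousLinearMap.inl ℝ P E ∘ fun x : P' × E' => h x.1) +
        ContinuousLinearMap.inr ℝ P E ∘ v ε := by
    ext x <;> simp
  have h1 : ContDiff ℝ ∞ (fun x : P' × E' => h x.1) := hh.comp contDiff_fst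
  have hk : (k : ℕ∞ω) ≤ ∞ := mod_cast le_top
  have h1' := h1.of_le hk
  have h2' := (hv ε).of_le hk
  rw [e, iteratedFDeriv_add_apply
    ((ContinuousLinearMap.contDiff _).comp h1').contDiffAt
    ((ContinuousLinearMap.contDiff _).comp h2').contDiffAt, abs_norm]
  refine (norm_add_le _ _).trans (le_trans ?_ (le_abs_self _))
  exact add_le_add (ContinuousLinearMap.norm_iteratedFDeriv_comp_left _ h1'.contDiffAt le_rfl)
    (ContinuousLinearMap.norm_iteratedFDeriv_comp_left _ h2'.contDiffAt le_rfl)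

theorem faa_bound {V W : Type} [NormedAddCommGroup V] [NormedSpace ℝ V] [NormedAddCommGroup W]
    [NormedSpace ℝ W] {f : V → W} {g : W → F} (hf : ContDiff ℝ ∞ f) (hg : ContDiff ℝ ∞ g)
    (k : ℕ) (x : V) :
    ‖iteratedFDeriv ℝ k (g ∘ f) x‖ ≤
      (∑ i ∈ Finset.range (k + 1), ‖iteratedFDeriv ℝ i g (f x)‖) *
        ((k.factorial : ℝ) * (1 + ∑ i ∈ Finset.range (k + 1), ‖iteratedFDeriv ℝ i f x‖) ^ k) := by
  have hle : ∀ (a : ℕ → ℝ), (∀ i, 0 ≤ a i) → ∀ i ≤ k, a i ≤ ∑ j ∈ Finset.range (k + 1), a j :=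
    fun a ha i hi => Finset.single_le_sum (f := a) (fun j _ => ha j)
      (Finset.mem_range.2 (Nat.lt_succ_of_le hi))
  have := norm_iteratedFDeriv_comp_le (n := k) hg hf (mod_cast le_top) x
    (C := ∑ i ∈ Finset.range (k + 1), ‖iteratedFDeriv ℝ i g (f x)‖)
    (D := 1 + ∑ i ∈ Finset.range (k + 1), ‖iteratedFDeriv ℝ i f x‖)
    (fun i hi => hle (fun i => ‖iteratedFDeriv ℝ i g (f x)‖) (fun _ => norm_nonneg _) i hi)
    (fun i h1 hi => by
      have h2 := hle (fun i => ‖iteratedFDeriv ℝ i f x‖) (fun _ => norm_nonneg _) i hi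
      have h3 : 0 ≤ ∑ i ∈ Finset.range (k + 1), ‖iteratedFDeriv ℝ i f x‖ :=
        Finset.sum_nonneg fun _ _ => norm_nonneg _
      refine le_trans ?_ (le_self_pow₀ (by linarith) (by omega))
      linarith)
  linarith

theorem contDiff_pair {h : P' → P} (hh : ContDiff ℝ ∞ h) {v : P' × E' → E}
    (hv : ContDiff ℝ ∞ v) : ContDiff ℝ ∞ (fun x : P' × E' => (h x.1, v x)) :=
  (hh.comp contDiff_fst).prodMk hv

theorem bd_zero_norm {l : Filter Eps} {K : Set P'} {v : Eps → P' × E' → E}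
    (hb : ∀ k, Bd l K (fun ε x => ‖iteratedFDeriv ℝ k (v ε) x‖)) :
    Bd l K (fun ε x => ‖v ε x‖) := by
  simpa using hb 0

theorem comp_bd (l : Filter Eps) {h : P' → P} (hh : ContDiff ℝ ∞ h) {K : Set P'}
    (hK : IsCompact K) {u : Eps → P × E → F} {v : Eps → P' × E' → E}
    (hu : ∀ ε, ContDiff ℝ ∞ (u ε)) (hv : ∀ ε, ContDiff ℝ ∞ (v ε))
    (hbu : ∀ k, Bd l (h '' K) (fun ε x => ‖iteratedFDeriv ℝ k (u ε) x‖))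
    (hbv : ∀ k, Bd l K (fun ε x => ‖iteratedFDeriv ℝ k (v ε) x‖)) (k : ℕ) :
    Bd l K (fun ε x => ‖iteratedFDeriv ℝ k (compNet h u v ε) x‖) := by
  have h1 := Bd.sum (Finset.range (k + 1)) (fun i _ => (hbu i).subst (bd_zero_norm hbv))
  have h2 := ((Bd.const (l := l) (K := K) 1).add (Bd.sum (Finset.range (k + 1))
    (fun i _ => bd_pair l hh hK hv hbv i))).pow k
  refine (h1.mul ((Bd.const (k.factorial : ℝ)).mul h2)).mono fun ε s hs y => ?_
  rw [abs_norm]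
  exact (faa_bound (contDiff_pair hh (hv ε)) (hu ε) k (s, y)).trans (le_abs_self _)

theorem comp_ng {h : P' → P} (hh : ContDiff ℝ ∞ h) {K : Set P'}
    (hK : IsCompact K) {u : Eps → P × E → F} {v : Eps → P' × E' → E}
    (hu : ∀ ε, ContDiff ℝ ∞ (u ε)) (hv : ∀ ε, ContDiff ℝ ∞ (v ε))
    (hbu : ∀ k, Ng (h '' K) (fun ε x => ‖iteratedFDeriv ℝ k (u ε) x‖))
    (hbv : ∀ k, Bd epsZero K (fun ε x => ‖iteratedFDeriv ℝ k (v ε) x‖)) (k : ℕ) :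
    Ng K (fun ε x => ‖iteratedFDeriv ℝ k (compNet h u v ε) x‖) := by
  have h1 := Ng.sum (Finset.range (k + 1)) (fun i _ => (hbu i).subst (bd_zero_norm hbv))
  have h2 := ((Bd.const (l := epsZero) (K := K) 1).add (Bd.sum (Finset.range (k + 1))
    (fun i _ => bd_pair epsZero hh hK hv hbv i))).pow k
  refine (h1.mul ((Bd.const (k.factorial : ℝ)).mul h2)).mono fun ε s hs y => ?_
  rw [abs_norm]
  exact (faa_bound (contDiff_pair hh (hv ε)) (hu ε) k (s, y)).trans (le_abs_self _)

theorem SlowlyIncreasing.comp {h : P' → P} (hh : ContDiff ℝ ∞ h) {u : P × E → F}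
    {v : P' × E' → E} (hu : SlowlyIncreasing u) (hv : SlowlyIncreasing v) :
    SlowlyIncreasing (fun x : P' × E' => u (h x.1, v x)) := by
  have ε₀ : Eps := ⟨1, one_pos, le_rfl⟩
  refine (slowlyIncreasing_iff ε₀).2 ⟨hu.1.comp (contDiff_pair hh hv.1), fun K hK k => ?_⟩
  exact comp_bd (pure ε₀) hh hK (u := fun _ => u) (v := fun _ => v) (fun _ => hu.1)
    (fun _ => hv.1) (((slowlyIncreasing_iff ε₀).1 hu).2 _ (hK.image hh.continuous))
    (((slowlyIncreasing_iff ε₀).1 hv).2 K hK) k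

theorem IsModerate.comp {h : P' → P} (hh : ContDiff ℝ ∞ h) {u : Eps → P × E → F}
    {v : Eps → P' × E' → E} (hu : IsModerate u) (hv : IsModerate v) :
    IsModerate (compNet h u v) :=
  isModerate_iff.2 ⟨fun ε => (hu.1 ε).comp hh (hv.1 ε), fun K hK k =>
    comp_bd epsZero hh hK (fun ε => (hu.1 ε).1) (fun ε => (hv.1 ε).1)
      ((isModerate_iff.1 hu).2 _ (hK.image hh.continuous)) ((isModerate_iff.1 hv).2 K hK) k⟩

theorem IsNegligible.comp_left {h : P' → P} (hh : ContDiff ℝ ∞ h) {u : Eps → P × E → F}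
    {v : Eps → P' × E' → E} (hu : IsNegligible u) (hv : IsModerate v) :
    IsNegligible (compNet h u v) :=
  isNegligible_iff.2 ⟨fun ε => (hu.1 ε).comp hh (hv.1 ε), fun K hK k =>
    comp_ng hh hK (fun ε => (hu.1 ε).1) (fun ε => (hv.1 ε).1)
      ((isNegligible_iff.1 hu).2 _ (hK.image hh.continuous)) ((isModerate_iff.1 hv).2 K hK) k⟩

/-- The net of total derivatives. -/
def fderivNet (u : Eps → P × E → F) : Eps → P × E → (P × E →L[ℝ] F) :=
  fun ε => fderiv ℝ (u ε)

theorem SlowlyIncreasing.fderiv {f : P × E → F} (hf : SlowlyIncreasing f) :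
    SlowlyIncreasing (fderiv ℝ f) := by
  refine ⟨hf.1.fderiv_right (m := ∞) (by simp), fun K hK k => ?_⟩
  simpa only [norm_iteratedFDeriv_fderiv] using hf.2 K hK (k + 1)

theorem IsModerate.fderiv {u : Eps → P × E → F} (hu : IsModerate u) :
    IsModerate (fderivNet u) := by
  refine ⟨fun ε => (hu.1 ε).fderiv, fun K hK k => ?_⟩
  simpa only [fderivNet, norm_iteratedFDeriv_fderiv] using hu.2 K hK (k + 1)

theorem IsNegligible.fderiv {u : Eps → P × E → F} (hu : IsNegligible u) :
    IsNegligible (fderivNet u) := by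
  refine ⟨fun ε => (hu.1 ε).fderiv, fun K hK k => ?_⟩
  simpa only [fderivNet, norm_iteratedFDeriv_fderiv] using hu.2 K hK (k + 1)

theorem diff_zero_ng {h : P' → P} (hh : ContDiff ℝ ∞ h) {u : Eps → P × E → F}
    {v v' : Eps → P' × E' → E} (hu : IsModerate u) (hv : IsModerate v) (hv' : IsModerate v')
    (hn : IsNegligible (v - v')) {K : Set P'} (hK : IsCompact K) :
    Ng K (fun ε x => ‖compNet h u v ε x - compNet h u v' ε x‖) := by
  obtain ⟨m, C, H⟩ := hu.2 _ (hK.image hh.continuous) 1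
  have bv := bd_zero_norm ((isModerate_iff.1 hv).2 K hK)
  have bv' := bd_zero_norm ((isModerate_iff.1 hv').2 K hK)
  have bn : Ng K (fun ε x => ‖(v - v') ε x‖) := by
    simpa using (isNegligible_iff.1 hn).2 K hK 0
  have be : Bd epsZero K (fun ε (_ : P' × E') => (ε : ℝ)⁻¹ ^ m) := by
    refine ⟨m, 1, zero_le_one, Eventually.of_forall fun ε s _ y => ?_⟩
    have hε := ε.2.1
    rw [abs_of_nonneg (by positivity), one_mul]
    exact le_mul_of_one_le_right (by positivity) (one_le_pow₀ (by linarith [norm_nonneg y]))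
  refine (bn.mul (((Bd.const |C|).mul be).mul
    (((Bd.const 1).add (bv.add bv')).pow m))).mono' (H.mono fun ε hε s hs y => ?_)
  have hpos := ε.2.1
  rw [abs_norm, abs_of_nonneg (by positivity)]
  set w := v ε (s, y)
  set w' := v' ε (s, y)
  have hd : Differentiable ℝ (u ε) := (hu.1 ε).1.differentiable (by simp)
  have hb : ∀ z ∈ segment ℝ (h s, w') (h s, w), ‖fderiv ℝ (u ε) z‖ ≤
      |C| * (ε : ℝ)⁻¹ ^ m * (1 + (‖w‖ + ‖w'‖)) ^ m := by
    rintro z ⟨α, β, hα, hβ, hαβ, rfl⟩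
    have e : α • (h s, w') + β • (h s, w) = (h s, α • w' + β • w) := by
      ext
      · simp [← add_smul, hαβ]
      · simp
    rw [e]
    have h1 := hε (h s) ⟨s, hs, rfl⟩ (α • w' + β • w)
    rw [show (1 : ℕ) = 0 + 1 from rfl, ← norm_iteratedFDeriv_fderiv, norm_iteratedFDeriv_zero] at h1
    refine h1.trans ?_
    have h2 : ‖α • w' + β • w‖ ≤ ‖w‖ + ‖w'‖ := by
      refine (norm_add_le _ _).trans ?_
      rw [norm_smul, norm_smul, Real.norm_of_nonneg hα, Real.norm_of_nonneg hβ]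
      nlinarith [norm_nonneg w, norm_nonneg w']
    gcongr
    exact le_abs_self C
  have := (convex_segment (𝕜 := ℝ) (h s, w') (h s, w)).norm_image_sub_le_of_norm_fderiv_le
    (fun z _ => hd z) hb (left_mem_segment ℝ _ _) (right_mem_segment ℝ _ _)
  have e2 : ‖(h s, w) - (h s, w')‖ = ‖(v - v') ε (s, y)‖ := by
    simp [Prod.norm_def, w, w']
  rw [e2, mul_comm] at this
  exact this

theorem clmComp_bound {D V W : Type} [NormedAddCommGroup D] [NormedSpace ℝ D]
    [NormedAddCommGroup V] [NormedSpace ℝ V] [NormedAddCommGroup W] [NormedSpace ℝ W]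
    {f : D → (W →L[ℝ] F)} {g : D → (V →L[ℝ] W)} (hf : ContDiff ℝ ∞ f) (hg : ContDiff ℝ ∞ g)
    (k : ℕ) (x : D) :
    ‖iteratedFDeriv ℝ k (fun y => (f y).comp (g y)) x‖ ≤ ∑ i ∈ Finset.range (k + 1),
      (k.choose i : ℝ) * ‖iteratedFDeriv ℝ i f x‖ * ‖iteratedFDeriv ℝ (k - i) g x‖ :=
  (ContinuousLinearMap.compL ℝ V W F).norm_iteratedFDeriv_le_of_bilinear_of_le_one hf hg x
    (mod_cast le_top) (ContinuousLinearMap.norm_compL_le ℝ V W F)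

theorem diff_ng {h : P' → P} (hh : ContDiff ℝ ∞ h) {v v' : Eps → P' × E' → E}
    (hv : IsModerate v) (hv' : IsModerate v') (hn : IsNegligible (v - v')) {K : Set P'}
    (hK : IsCompact K) (k : ℕ) : ∀ {F : Type} [NormedAddCommGroup F] [NormedSpace ℝ F]
      {u : Eps → P × E → F}, IsModerate u →
      Ng K (fun ε x => ‖iteratedFDeriv ℝ k (fun x => compNet h u v ε x - compNet h u v' ε x) x‖) := by
  induction k using Nat.strong_induction_on with
  | _ k ih =>
  intro F _ _ u hu
  rcases k with _ | k
  · simpa using diff_zero_ng hh hu hv hv' hn hK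
  have hpf := fun ε => contDiff_pair hh (hv.1 ε).1
  have hpf' := fun ε => contDiff_pair hh (hv'.1 ε).1
  have hDu : ∀ ε, ContDiff ℝ ∞ (fderiv ℝ (u ε)) := fun ε => (hu.fderiv.1 ε).1
  let f : Eps → P' × E' → P × E := fun ε x => (h x.1, v ε x)
  let f' : Eps → P' × E' → P × E := fun ε x => (h x.1, v' ε x)
  have hDf : ∀ ε, ContDiff ℝ ∞ (fderiv ℝ (f ε)) := fun ε => (hpf ε).fderiv_right (by simp)
  have hDf' : ∀ ε, ContDiff ℝ ∞ (fderiv ℝ (f' ε)) := fun ε => (hpf' ε).fderiv_right (by simp)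
  have key : ∀ ε, fderiv ℝ (fun x => compNet h u v ε x - compNet h u v' ε x) =
      (fun x => (compNet h (fderivNet u) v ε x - compNet h (fderivNet u) v' ε x).comp
        (fderiv ℝ (f ε) x)) +
      (fun x => (compNet h (fderivNet u) v' ε x).comp (fderiv ℝ (f ε) x - fderiv ℝ (f' ε) x)) := by
    intro ε
    have hd : Differentiable ℝ (u ε) := (hu.1 ε).1.differentiable (by simp)
    have h1 : Differentiable ℝ (f ε) := (hpf ε).differentiable (by simp)
    have h2 : Differentiable ℝ (f' ε) := (hpf' ε).differentiable (by simp)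
    ext1 x
    have e1 : fderiv ℝ (compNet h u v ε) x = (fderiv ℝ (u ε) (f ε x)).comp (fderiv ℝ (f ε) x) :=
      fderiv_comp x (hd _) (h1 x)
    have e2 : fderiv ℝ (compNet h u v' ε) x =
        (fderiv ℝ (u ε) (f' ε x)).comp (fderiv ℝ (f' ε) x) :=
      fderiv_comp x (hd _) (h2 x)
    have e3 : fderiv ℝ (fun x => compNet h u v ε x - compNet h u v' ε x) x =
        fderiv ℝ (compNet h u v ε) x - fderiv ℝ (compNet h u v' ε) x :=
      fderiv_fun_sub ((hd.comp h1) x) ((hd.comp h2) x)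
    rw [e3, e1, e2]
    simp only [Pi.add_apply, compNet, fderivNet, f, f',
      ContinuousLinearMap.sub_comp, ContinuousLinearMap.comp_sub]
    abel
  have hN1 : ∀ i ≤ k, Ng K (fun ε x => ‖iteratedFDeriv ℝ i
      (fun x => compNet h (fderivNet u) v ε x - compNet h (fderivNet u) v' ε x) x‖) :=
    fun i hi => ih i (Nat.lt_succ_of_le hi) hu.fderiv
  have hB1 : ∀ i, Bd epsZero K (fun ε x => ‖iteratedFDeriv ℝ i (fderiv ℝ (f ε)) x‖) := fun i => by
    simp only [norm_iteratedFDeriv_fderiv]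
    exact bd_pair epsZero hh hK (fun ε => (hv.1 ε).1) ((isModerate_iff.1 hv).2 K hK) (i + 1)
  have hB2 : ∀ i, Bd epsZero K
      (fun ε x => ‖iteratedFDeriv ℝ i (compNet h (fderivNet u) v' ε) x‖) :=
    (isModerate_iff.1 (hu.fderiv.comp hh hv')).2 K hK
  have hN2 : ∀ i, Ng K (fun ε x => ‖iteratedFDeriv ℝ i
      (fun x => fderiv ℝ (f ε) x - fderiv ℝ (f' ε) x) x‖) := by
    intro i
    refine (((isNegligible_iff.1 hn).2 K hK (i + 1)).mul
      (Bd.const ‖ContinuousLinearMap.inr ℝ P E‖)).mono fun ε s hs y => ?_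
    have h1 : Differentiable ℝ (f ε) := (hpf ε).differentiable (by simp)
    have h2 : Differentiable ℝ (f' ε) := (hpf' ε).differentiable (by simp)
    have e : (fun x => fderiv ℝ (f ε) x - fderiv ℝ (f' ε) x) =
        fderiv ℝ (ContinuousLinearMap.inr ℝ P E ∘ ((v - v') ε)) := by
      ext1 x
      rw [← fderiv_fun_sub (h1 x) (h2 x)]
      congr 1
      ext x <;> simp [f, f']
    rw [e, norm_iteratedFDeriv_fderiv, abs_norm, mul_comm]
    have h3 := (ContinuousLinearMap.inr ℝ P E).norm_iteratedFDeriv_comp_left (x := (s, y))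
      (n := i + 1) (N := ∞) (hn.1 ε).1.contDiffAt (mod_cast le_top)
    exact h3.trans (le_abs_self _)
  have hS1 := Ng.sum (Finset.range (k + 1)) (fun i hi =>
    ((hN1 i (Nat.lt_succ_iff.1 (Finset.mem_range.1 hi))).mul (Bd.const (k.choose i : ℝ))).mul
      (hB1 (k - i)))
  have hS2 := Ng.sum (Finset.range (k + 1)) (fun i _ =>
    ((hN2 (k - i)).mul (Bd.const (k.choose i : ℝ))).mul (hB2 i))
  refine (hS1.add hS2).mono fun ε s hs y => ?_
  rw [← norm_iteratedFDeriv_fderiv, key, abs_norm]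
  have hk : (k : ℕ∞ω) ≤ ∞ := mod_cast le_top
  have c1 : ContDiff ℝ ∞ (fun x => compNet h (fderivNet u) v ε x - compNet h (fderivNet u) v' ε x) :=
    ((hDu ε).comp (hpf ε)).sub ((hDu ε).comp (hpf' ε))
  have c2 : ContDiff ℝ ∞ (compNet h (fderivNet u) v' ε) := (hDu ε).comp (hpf' ε)
  have c3 : ContDiff ℝ ∞ (fun x => fderiv ℝ (f ε) x - fderiv ℝ (f' ε) x) := (hDf ε).sub (hDf' ε)
  have d1 := c1.clm_comp (hDf ε)
  have d2 := c2.clm_comp c3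
  rw [iteratedFDeriv_add_apply (d1.of_le hk).contDiffAt (d2.of_le hk).contDiffAt]
  refine (norm_add_le _ _).trans (le_trans ?_ (le_abs_self _))
  refine add_le_add ?_ ?_
  · refine (clmComp_bound c1 (hDf ε) k (s, y)).trans (le_of_eq ?_)
    exact Finset.sum_congr rfl fun i _ => by ring
  · refine (clmComp_bound c2 c3 k (s, y)).trans (le_of_eq ?_)
    exact Finset.sum_congr rfl fun i _ => by ring

/-- Composition does not depend on the chosen representatives. -/
theorem IsNegligible.comp_congr {h : P' → P} (hh : ContDiff ℝ ∞ h) {u u' : Eps → P × E → F}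
    {v v' : Eps → P' × E' → E} (hu' : IsModerate u') (hv : IsModerate v)
    (hv' : IsModerate v') (hnu : IsNegligible (u - u')) (hnv : IsNegligible (v - v')) :
    IsNegligible (compNet h u v - compNet h u' v') := by
  have e : compNet h u v - compNet h u' v' =
      compNet h (u - u') v + (compNet h u' v - compNet h u' v') := by
    ext ε x
    simp [compNet]
  rw [e]
  refine (hnu.comp_left hh hv).add (isNegligible_iff.2 ⟨fun ε => ?_, fun K hK k =>
    diff_ng hh hv hv' hnv hK k hu'⟩)
  have := ((hu'.comp hh hv).1 ε).add ((hu'.comp hh hv').1 ε).neg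
  rwa [← sub_eq_add_neg] at this

end Composition

section Algebras

variable (P E F : Type) [NormedAddCommGroup P] [NormedSpace ℝ P]
  [NormedAddCommGroup E] [NormedSpace ℝ E] [NormedAddCommGroup F] [NormedSpace ℝ F]

/-- The group of moderate nets. -/
def moderateNets : AddSubgroup (Eps → P × E → F) where
  carrier := {u | IsModerate u}
  add_mem' := IsModerate.add
  zero_mem' := IsNegligible.zero.isModerate
  neg_mem' := IsModerate.neg

/-- The group of negligible nets. -/
def negligibleNets : AddSubgroup (Eps → P × E → F) where
  carrier := {u | IsNegligible u}
  add_mem' := IsNegligible.add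
  zero_mem' := IsNegligible.zero
  neg_mem' := IsNegligible.neg

/-- The space `𝓖̃_τ(P × E)` of `F`-valued Colombeau generalized functions on `P × E` with
`𝓖`-bounds in the `P`-variable and `𝓖_τ`-bounds in the `E`-variable: moderate nets modulo
negligible nets.  For `F = ℝᵐ` this is `𝓖̃_τ(P × E)ᵐ`. -/
abbrev GMixed : Type :=
  moderateNets P E F ⧸ (negligibleNets P E F).addSubgroupOf (moderateNets P E F)

/-- The one point space `ℝ⁰`. -/
abbrev R0 : Type := Fin 0 → ℝ

/-- Tempered generalized functions `𝓖_τ(E)` with values in `F`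
(no variable with local bounds). -/
abbrev GTau : Type := GMixed R0 E F

/-- Generalized functions `𝓖(P)` with values in `F` (no variable with tempered bounds). -/
abbrev GLoc : Type := GMixed P R0 F

/-- Generalized points of `F`: for `F = ℝ` the ring `𝓡` of generalized numbers,
for `F = ℝⁿ` the space `𝓡ⁿ`. -/
abbrev GPoint : Type := GMixed R0 R0 F

end Algebras

section Operations

variable {P E P' E' F F' : Type} [NormedAddCommGroup P] [NormedSpace ℝ P]
  [NormedAddCommGroup E] [NormedSpace ℝ E] [NormedAddCommGroup P'] [NormedSpace ℝ P']
  [NormedAddCommGroup E'] [NormedSpace ℝ E'] [NormedAddCommGroup F] [NormedSpace ℝ F]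
  [NormedAddCommGroup F'] [NormedSpace ℝ F']

/-- The class of a moderate net. -/
def GMixed.mk (u : Eps → P × E → F) (hu : IsModerate u) : GMixed P E F :=
  QuotientAddGroup.mk ⟨u, hu⟩

theorem rel_iff {a b : moderateNets P E F} :
    QuotientAddGroup.leftRel ((negligibleNets P E F).addSubgroupOf (moderateNets P E F)) a b ↔
      IsNegligible (a.1 - b.1) := by
  rw [QuotientAddGroup.leftRel_apply, AddSubgroup.mem_addSubgroupOf]
  constructor
  · intro h
    have h' : IsNegligible _ := (negligibleNets P E F).neg_mem h
    simpa [sub_eq_add_neg, add_comm] using h'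
  · intro h
    have h' : IsNegligible _ := (negligibleNets P E F).neg_mem h
    simpa [sub_eq_add_neg, add_comm, negligibleNets] using h'

theorem GMixed.mk_eq_mk {u v : Eps → P × E → F} {hu : IsModerate u} {hv : IsModerate v} :
    GMixed.mk u hu = GMixed.mk v hv ↔ IsNegligible (u - v) :=
  Quotient.eq''.trans (rel_iff (a := ⟨u, hu⟩) (b := ⟨v, hv⟩))

/-- Composition by componentwise insertion: the class of `(s, y) ↦ u_ε(h(s), v_ε(s, y))`, for a
smooth map `h` between the parameter spaces. -/
def GMixed.comp (h : P' → P) (hh : ContDiff ℝ ∞ h) (U : GMixed P E F) (V : GMixed P' E' E) :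
    GMixed P' E' F :=
  Quotient.map₂ (fun a b => ⟨compNet h a.1 b.1, a.2.comp hh b.2⟩)
    (fun a a' ha b b' hb => rel_iff.2 (show IsNegligible (compNet h a.1 b.1 - compNet h a'.1 b'.1)
      from IsNegligible.comp_congr hh a'.2 b.2 b'.2 (rel_iff.1 ha) (rel_iff.1 hb))) U V

/-- The total derivative: the class of `(D u_ε)`. -/
def GMixed.fderiv (U : GMixed P E F) : GMixed P E (P × E →L[ℝ] F) :=
  Quotient.map (fun a => ⟨fderivNet a.1, IsModerate.fderiv a.2⟩)
    (fun a a' ha => rel_iff.2 (by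
      have e : fderivNet a.1 - fderivNet a'.1 = fderivNet (a.1 - a'.1) := by
        ext1 ε
        ext1 x
        exact (fderiv_sub ((a.2.1 ε).1.differentiable (by simp) x)
          ((a'.2.1 ε).1.differentiable (by simp) x)).symm
      have := (rel_iff.1 ha).fderiv
      rwa [← e] at this)) U

theorem isModerate_const (P : Type) [NormedAddCommGroup P] [NormedSpace ℝ P] {f : E → F}
    (hf : f.HasTemperateGrowth) : IsModerate (fun (_ : Eps) (x : P × E) => f x.2) := by
  have key : ∀ (l : Filter Eps) (K : Set P) (k : ℕ), Bd l K
      (fun _ x => ‖iteratedFDeriv ℝ k (fun x : P × E => f x.2) x‖) := by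
    intro l K k
    obtain ⟨m, C, H⟩ := hf.2 k
    have h1 : Bd l K (fun _ (x : P × E) => (1 + ‖x.2‖) ^ m) := by
      refine ⟨m, 1, zero_le_one, Eventually.of_forall fun ε s _ y => ?_⟩
      have h1 := one_le_pow₀ (one_le_inv_eps ε) (n := m)
      have h2 : 0 ≤ (1 + ‖y‖) ^ m := by positivity
      rw [abs_of_nonneg h2, one_mul]
      nlinarith
    refine (((Bd.const C).mul h1).mul
      (Bd.const (∏ _i : Fin k, ‖ContinuousLinearMap.snd ℝ P E‖))).mono fun ε s hs y => ?_
    have := ContinuousLinearMap.iteratedFDeriv_comp_right (ContinuousLinearMap.snd ℝ P E) hf.1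
      (s, y) (i := k) (mod_cast le_top)
    have h2 : (fun x : P × E => f x.2) = f ∘ (ContinuousLinearMap.snd ℝ P E) := rfl
    rw [h2, this, abs_norm]
    refine (ContinuousMultilinearMap.norm_compContinuousLinearMap_le _ _).trans
      (le_trans ?_ (le_abs_self _))
    gcongr
    exact H y
  have ε₀ : Eps := ⟨1, one_pos, le_rfl⟩
  exact isModerate_iff.2 ⟨fun ε => (slowlyIncreasing_iff ε₀).2
    ⟨hf.1.comp contDiff_snd, fun K _ k => key _ K k⟩, fun K _ k => key _ K k⟩

/-- A slowly increasing function `f ∈ 𝒪_M(E)` as a generalized function on `P × E`,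
`(s, y) ↦ f(y)`. -/
def ofSlow (P : Type) [NormedAddCommGroup P] [NormedSpace ℝ P] (f : E → F)
    (hf : f.HasTemperateGrowth) : GMixed P E F :=
  GMixed.mk (fun _ x => f x.2) (isModerate_const P hf)

/-- The projection `(s, y) ↦ A y` for a linear map `A`. -/
def ofLin (P : Type) [NormedAddCommGroup P] [NormedSpace ℝ P] (A : E →L[ℝ] F) : GMixed P E F :=
  ofSlow P A A.hasTemperateGrowth

/-- The projection `(s, y) ↦ y`. -/
def proj (P E : Type) [NormedAddCommGroup P] [NormedSpace ℝ P] [NormedAddCommGroup E]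
    [NormedSpace ℝ E] : GMixed P E E :=
  ofLin P (ContinuousLinearMap.id ℝ E)

/-- `U ∘ V` for a tempered generalized function `U`. -/
def GTau.comp (U : GTau E F) (V : GMixed P' E' E) : GMixed P' E' F :=
  GMixed.comp (fun _ => 0) contDiff_const U V

/-- `A ∘ V` for a linear map `A`. -/
def GMixed.lin (A : E →L[ℝ] F) (V : GMixed P' E' E) : GMixed P' E' F :=
  GTau.comp (ofLin R0 A) V

/-- `(s, y) ↦ U(s, V(s, y))`. -/
def GMixed.insert (U : GMixed P E F) (V : GMixed P E' E) : GMixed P E' F :=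
  GMixed.comp (fun s => s) contDiff_id U V

/-- `U ∘ A` for a linear map `A`. -/
def GTau.pull (A : E' →L[ℝ] E) (U : GTau E F) : GTau E' F :=
  GTau.comp U (ofLin R0 A)

/-- The restriction `y ↦ U(s₀, y)`. -/
def GMixed.atParam (s₀ : P) (U : GMixed P E F) : GTau E F :=
  GMixed.comp (fun _ : R0 => s₀) contDiff_const U (proj R0 E)

/-- The value of `U ∈ 𝓖(P)` at the point `s₀`. -/
def GLoc.eval (s₀ : P) (U : GLoc P F) : GPoint F := GMixed.atParam s₀ U

/-- The pair `(U, V)`. -/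
def GMixed.pair (U : GMixed P E F) (V : GMixed P E F') : GMixed P E (F × F') :=
  U.lin (ContinuousLinearMap.inl ℝ F F') + V.lin (ContinuousLinearMap.inr ℝ F F')

/-- The tuple `(U_i)_i`. -/
def GMixed.tuple {ι : Type} [Fintype ι] [DecidableEq ι] (U : ι → GMixed P E F) :
    GMixed P E (ι → F) :=
  ∑ i, (U i).lin (ContinuousLinearMap.single ℝ (fun _ : ι => F) i)

theorem mul_hasTemperateGrowth : (fun z : ℝ × ℝ => z.1 * z.2).HasTemperateGrowth :=
  (ContinuousLinearMap.fst ℝ ℝ ℝ).hasTemperateGrowth.mul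
    (ContinuousLinearMap.snd ℝ ℝ ℝ).hasTemperateGrowth

/-- The (componentwise) product of scalar generalized functions. -/
instance : Mul (GMixed P E ℝ) :=
  ⟨fun U V => GTau.comp (ofSlow R0 (fun z : ℝ × ℝ => z.1 * z.2) mul_hasTemperateGrowth)
    (U.pair V)⟩

/-- The derivative `∂_v U` in the direction of the constant vector `v ∈ P × E`. -/
def GMixed.dirDeriv (v : P × E) (U : GMixed P E F) : GMixed P E F :=
  U.fderiv.lin (ContinuousLinearMap.apply ℝ F v)

/-- The derivative `∂_v U` of a tempered generalized function on `E` in the direction `v ∈ E`. -/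
def GTau.dirDeriv (v : E) (U : GTau E F) : GTau E F := GMixed.dirDeriv ((0 : R0), v) U

/-- The generalized vector field `f ∂_v` on `E`, for `v ∈ E` a constant vector. Generalized vector
fields `∑ ξ_i ∂_{x_i}` on `E` are identified with their coefficient vectors in `𝓖_τ(E)` with
values in `E`. -/
def GTau.vec (f : GTau E ℝ) (v : E) : GTau E E :=
  GMixed.lin (ContinuousLinearMap.toSpanSingleton ℝ v) f

end Operations

section GroupActions

variable {E : Type} [NormedAddCommGroup E] [NormedSpace ℝ E]

/-- Generalized group actions on `E`: `Φ(0, ·) = id` in `𝓖_τ(E)` and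
`Φ(η₁ + η₂, ·) = Φ(η₁, Φ(η₂, ·))` in `𝓖̃_τ(ℝ² × E)`. -/
structure IsGroupAction (Φ : GMixed ℝ E E) : Prop where
  zero : Φ.atParam 0 = proj R0 E
  add : GMixed.comp (fun η : ℝ × ℝ => η.1 + η.2) (contDiff_fst.add contDiff_snd) Φ
      (proj (ℝ × ℝ) E) =
    GMixed.comp (fun η : ℝ × ℝ => η.1) contDiff_fst Φ
      (GMixed.comp (fun η : ℝ × ℝ => η.2) contDiff_snd Φ (proj (ℝ × ℝ) E))

/-- The generalized vector field `d/dη|₀ Φ(η, ·)`. -/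
def generator (Φ : GMixed ℝ E E) : GTau E E :=
  (Φ.dirDeriv ((1 : ℝ), (0 : E))).atParam 0

/-- `𝓖`-completeness: the initial value problem `ẋ(t) = ξ(x(t))`, `x(t₀) = x₀` is uniquely
solvable in `𝓖(ℝ)` for all real `t₀` and all generalized points `x₀`. -/
def IsGComplete (ξ : GTau E E) : Prop :=
  ∀ (t₀ : ℝ) (x₀ : GPoint E), ∃! x : GLoc ℝ E,
    GMixed.dirDeriv ((1 : ℝ), (0 : R0)) x = GTau.comp ξ x ∧ GLoc.eval t₀ x = x₀

end GroupActions

section Jets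

/-- Multi-indices of order at most `n` in `p` variables. -/
abbrev MultiIdx (p n : ℕ) : Type := {J : Fin p → ℕ // ∑ i, J i ≤ n}

instance (p n : ℕ) : Fintype (MultiIdx p n) :=
  Fintype.ofInjective (fun (J : MultiIdx p n) (i : Fin p) =>
      (⟨J.1 i, Nat.lt_succ_of_le ((Finset.single_le_sum (fun j _ => Nat.zero_le (J.1 j))
        (Finset.mem_univ i)).trans J.2)⟩ : Fin (n + 1)))
    (fun _ _ h => Subtype.ext (funext fun i => congrArg Fin.val (congrFun h i)))

/-- The empty multi-index. -/
def MultiIdx.zero (p n : ℕ) : MultiIdx p n := ⟨fun _ => 0, by simp⟩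

/-- The multi-index of an unordered tuple `(j₁, …, j_k)`, `k ≤ n`. -/
def MultiIdx.ofList {p n : ℕ} (l : List (Fin p)) (hl : l.length ≤ n) : MultiIdx p n :=
  ⟨fun i => l.count i, by
    have h := Multiset.sum_count_eq_card (s := Finset.univ) (m := (l : Multiset (Fin p)))
      (fun a _ => Finset.mem_univ a)
    simp only [Multiset.coe_count, Multiset.coe_card] at h
    exact h.trans_le hl⟩

/-- The multi-index `(J, i)`. -/
def MultiIdx.succ {p n : ℕ} (J : MultiIdx p n) (i : Fin p) : MultiIdx p (n + 1) :=
  ⟨J.1 + Pi.single i 1, by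
    simp only [Pi.add_apply, Finset.sum_add_distrib, Finset.sum_pi_single', Finset.mem_univ,
      if_true]
    exact Nat.succ_le_succ J.2⟩

/-- The `n`-jet space `(ℝᵖ × ℝ^q)⁽ⁿ⁾` with coordinates `(x, u⁽ⁿ⁾) = (x_i, u_J^α)`, `|J| ≤ n`. -/
abbrev Jet (p q n : ℕ) : Type := (Fin p → ℝ) × (MultiIdx p n → Fin q → ℝ)

variable (p q : ℕ)

/-- The projection `(x, u⁽ⁿ⁾) ↦ x`. -/
def jetX (n : ℕ) : Jet p q n →L[ℝ] (Fin p → ℝ) := ContinuousLinearMap.fst ℝ _ _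

/-- The projection `(x, u⁽ⁿ⁾) ↦ (x, u)`. -/
def jetXU (n : ℕ) : Jet p q n →L[ℝ] (Fin p → ℝ) × (Fin q → ℝ) :=
  (jetX p q n).prod ((ContinuousLinearMap.proj (MultiIdx.zero p n)).comp
    (ContinuousLinearMap.snd ℝ _ _))

/-- The coordinate function `u_J^α`. -/
def jetU {n : ℕ} (J : MultiIdx p n) (α : Fin q) : Jet p q n →L[ℝ] ℝ :=
  (ContinuousLinearMap.proj (φ := fun _ : Fin q => ℝ) α).comp
    ((ContinuousLinearMap.proj (φ := fun _ : MultiIdx p n => Fin q → ℝ) J).comp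
      (ContinuousLinearMap.snd ℝ _ _))

/-- The projection from `n`-jets to `m`-jets, `m ≤ n`. -/
def jetForget {m n : ℕ} (h : m ≤ n) : Jet p q n →L[ℝ] Jet p q m :=
  (jetX p q n).prod ((ContinuousLinearMap.pi fun J : MultiIdx p m =>
    ContinuousLinearMap.proj (⟨J.1, J.2.trans h⟩ : MultiIdx p n)).comp
      (ContinuousLinearMap.snd ℝ _ _))

/-- The coordinate direction of `x_i` in the jet space. -/
def jetDx (n : ℕ) (i : Fin p) : Jet p q n := (Pi.single i 1, 0)

/-- The coordinate direction of `u_J^α` in the jet space. -/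
def jetDu {n : ℕ} (J : MultiIdx p n) (α : Fin q) : Jet p q n :=
  (0, Pi.single J (Pi.single α 1))

/-- The Taylor polynomial `h_z(y)^α = ∑_{|J| ≤ n} u_J^α (y - x)^J / J!`, the polynomial of degree
at most `n` whose `n`-jet at `x` is `z = (x, u⁽ⁿ⁾)`; as a function of `(z, y)`. -/
def taylorPoly (n : ℕ) (w : Jet p q n × (Fin p → ℝ)) : Fin q → ℝ :=
  ∑ J : MultiIdx p n, (∏ i, (w.2 i - w.1.1 i) ^ J.1 i / ((J.1 i).factorial : ℝ)) • w.1.2 J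

theorem taylorPoly_hasTemperateGrowth (n : ℕ) : (taylorPoly p q n).HasTemperateGrowth := by
  have hx : ∀ i, (fun w : Jet p q n × (Fin p → ℝ) => w.2 i - w.1.1 i).HasTemperateGrowth :=
    fun i => (((ContinuousLinearMap.proj (R := ℝ) (φ := fun _ : Fin p => ℝ) i).comp
      (ContinuousLinearMap.snd ℝ (Jet p q n) (Fin p → ℝ))) -
      ((ContinuousLinearMap.proj (R := ℝ) (φ := fun _ : Fin p => ℝ) i).comp ((jetX p q n).comp
        (ContinuousLinearMap.fst ℝ (Jet p q n) (Fin p → ℝ))))).hasTemperateGrowth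
  have hp : ∀ (J : MultiIdx p n) (s : Finset (Fin p)),
      (fun w : Jet p q n × (Fin p → ℝ) =>
        ∏ i ∈ s, (w.2 i - w.1.1 i) ^ J.1 i / ((J.1 i).factorial : ℝ)).HasTemperateGrowth := by
    intro J s
    induction s using Finset.induction_on with
    | empty => simp
    | insert i s hi ih =>
      simp only [Finset.prod_insert hi, div_eq_mul_inv] at ih ⊢
      exact (((hx i).pow _).mul (.const _)).mul ih
  have hu : ∀ J : MultiIdx p n,
      (fun w : Jet p q n × (Fin p → ℝ) => w.1.2 J).HasTemperateGrowth :=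
    fun J => ((ContinuousLinearMap.proj (R := ℝ) (φ := fun _ : MultiIdx p n => Fin q → ℝ) J).comp
      ((ContinuousLinearMap.snd ℝ (Fin p → ℝ) (MultiIdx p n → Fin q → ℝ)).comp
        (ContinuousLinearMap.fst ℝ (Jet p q n) (Fin p → ℝ)))).hasTemperateGrowth
  exact Function.HasTemperateGrowth.sum fun J _ => (hp J Finset.univ).smul (hu J)

end Jets

section Prolongation

variable {p q : ℕ}

/-- The map `Φ(η, (x, u)) = (Ξ_η(x), Ψ_η(x, u))`. -/
def projectable (Ξ : GMixed ℝ (Fin p → ℝ) (Fin p → ℝ))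
    (Ψ : GMixed ℝ ((Fin p → ℝ) × (Fin q → ℝ)) (Fin q → ℝ)) :
    GMixed ℝ ((Fin p → ℝ) × (Fin q → ℝ)) ((Fin p → ℝ) × (Fin q → ℝ)) :=
  (Ξ.insert (ofLin ℝ (ContinuousLinearMap.fst ℝ _ _))).pair Ψ

variable (p q) in
/-- Projectable generalized group actions on `ℝᵖ × ℝ^q`. -/
structure ProjAction where
  /-- the action `Ξ_η(x)` on the independent variables -/
  Ξ : GMixed ℝ (Fin p → ℝ) (Fin p → ℝ)
  /-- the component `Ψ_η(x, u)` -/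
  Ψ : GMixed ℝ ((Fin p → ℝ) × (Fin q → ℝ)) (Fin q → ℝ)
  isGroupAction : IsGroupAction (projectable Ξ Ψ)

/-- The underlying generalized group action. -/
def ProjAction.action (Φ : ProjAction p q) :
    GMixed ℝ ((Fin p → ℝ) × (Fin q → ℝ)) ((Fin p → ℝ) × (Fin q → ℝ)) :=
  projectable Φ.Ξ Φ.Ψ

/-- The action on a family of functions `U(z, ·)` of the independent variables `y`, where
`z` is a parameter:
`(η, z, y) ↦ Φ_η(U(z, ·))(y) = Ψ_η(Ξ_{-η}(y), U(z, Ξ_{-η}(y)))`. -/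
def ProjAction.actOn {Z : Type} [NormedAddCommGroup Z] [NormedSpace ℝ Z] (Φ : ProjAction p q)
    (U : GTau (Z × (Fin p → ℝ)) (Fin q → ℝ)) : GMixed ℝ (Z × (Fin p → ℝ)) (Fin q → ℝ) :=
  let y' : GMixed ℝ (Z × (Fin p → ℝ)) (Fin p → ℝ) :=
    GMixed.comp (fun η : ℝ => -η) contDiff_neg Φ.Ξ (ofLin ℝ (ContinuousLinearMap.snd ℝ _ _))
  Φ.Ψ.insert (y'.pair (U.comp ((ofLin ℝ (ContinuousLinearMap.fst ℝ _ _)).pair y')))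

/-- The partial derivative `∂_y^J` of a function of `(η, z, y)`, `y ∈ ℝᵖ`. -/
def partialY {Z F : Type} [NormedAddCommGroup Z] [NormedSpace ℝ Z] [NormedAddCommGroup F]
    [NormedSpace ℝ F] (J : Fin p → ℕ) (W : GMixed ℝ (Z × (Fin p → ℝ)) F) :
    GMixed ℝ (Z × (Fin p → ℝ)) F :=
  (List.finRange p).foldr (fun i V =>
    (GMixed.dirDeriv ((0 : ℝ), ((0 : Z), (Pi.single i 1 : Fin p → ℝ))))^[J i] V) W

/-- The `n`-th prolongation
`pr⁽ⁿ⁾Φ(η, z) = (Ξ_η(x), pr⁽ⁿ⁾(Φ_η(h_z))(Ξ_η(x)))`, `z = (x, u⁽ⁿ⁾)`,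
where `h_z` is a function with `n`-jet `z` at `x`, namely the Taylor polynomial. -/
def ProjAction.prolong (n : ℕ) (Φ : ProjAction p q) : GMixed ℝ (Jet p q n) (Jet p q n) :=
  let x' : GMixed ℝ (Jet p q n) (Fin p → ℝ) := Φ.Ξ.insert (ofLin ℝ (jetX p q n))
  let W : GMixed ℝ (Jet p q n × (Fin p → ℝ)) (Fin q → ℝ) :=
    Φ.actOn (ofSlow R0 (taylorPoly p q n) (taylorPoly_hasTemperateGrowth p q n))
  x'.pair (GMixed.tuple fun J : MultiIdx p n =>
    (partialY J.1 W).insert ((proj ℝ (Jet p q n)).pair x'))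

/-- `X` is a `𝓖`-`n`-complete generalized vector field with corresponding projectable group
action `Φ`: `X` is `𝓖`-complete and generates `Φ`, and `pr⁽ⁿ⁾Φ` is `𝓖`-complete as well. -/
structure IsGNComplete (n : ℕ)
    (X : GTau ((Fin p → ℝ) × (Fin q → ℝ)) ((Fin p → ℝ) × (Fin q → ℝ)))
    (Φ : ProjAction p q) : Prop where
  generates : generator Φ.action = X
  complete : IsGComplete X
  prolong_complete : IsGComplete (generator (Φ.prolong n))

/-- The prolongation `pr⁽ⁿ⁾X` of the generator `X` of `Φ`: the generator
`d/dη|₀ pr⁽ⁿ⁾Φ_η` of the prolonged action. -/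
def ProjAction.prolongedField (n : ℕ) (Φ : ProjAction p q) : GTau (Jet p q n) (Jet p q n) :=
  generator (Φ.prolong n)

/-- The generalized vector field `∑ ξ_i(x) ∂_{x_i} + ∑ ψ_α(x,u) ∂_{u^α}` on `ℝᵖ × ℝ^q`. -/
def pointField (ξ : Fin p → GTau (Fin p → ℝ) ℝ)
    (ψ : Fin q → GTau ((Fin p → ℝ) × (Fin q → ℝ)) ℝ) :
    GTau ((Fin p → ℝ) × (Fin q → ℝ)) ((Fin p → ℝ) × (Fin q → ℝ)) :=
  ∑ i, GTau.vec (GTau.pull (ContinuousLinearMap.fst ℝ _ _) (ξ i)) (Pi.single i 1, 0) +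
    ∑ α, GTau.vec (ψ α) (0, Pi.single α 1)

/-- The generalized vector field `∑ ξ_i(x) ∂_{x_i} + ∑ ψ_α(x,u) ∂_{u^α} + ∑_α ∑_J c_α^J ∂_{u_J^α}`
on the jet space, where the last sum runs over the multi-indices `1 ≤ |J| ≤ n`. -/
def jetField (n : ℕ) (ξ : Fin p → GTau (Fin p → ℝ) ℝ)
    (ψ : Fin q → GTau ((Fin p → ℝ) × (Fin q → ℝ)) ℝ)
    (c : Fin q → MultiIdx p n → GTau (Jet p q n) ℝ) : GTau (Jet p q n) (Jet p q n) :=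
  ∑ i, GTau.vec (GTau.pull (jetX p q n) (ξ i)) (jetDx p q n i) +
    ∑ α, GTau.vec (GTau.pull (jetXU p q n) (ψ α)) (jetDu p q (MultiIdx.zero p n) α) +
    ∑ α, ∑ J ∈ Finset.univ.filter (fun J : MultiIdx p n => J ≠ MultiIdx.zero p n),
      GTau.vec (c α J) (jetDu p q J α)

/-- The total derivative
`D_i f = ∂f/∂x_i + ∑_β ∑_{|J| ≤ k} u_{J,i}^β ∂f/∂u_J^β`
of a generalized function of `k`-jets, a generalized function of `(k+1)`-jets. -/
def totalD (k : ℕ) (i : Fin p) (f : GTau (Jet p q k) ℝ) : GTau (Jet p q (k + 1)) ℝ :=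
  GTau.pull (jetForget p q k.le_succ) (GTau.dirDeriv (jetDx p q k i) f) +
    ∑ β, ∑ J : MultiIdx p k, ofLin R0 (jetU p q (J.succ i) β) *
      GTau.pull (jetForget p q k.le_succ) (GTau.dirDeriv (jetDu p q J β) f)

/-- The iterated total derivative `D_J = D_{j₁} ⋯ D_{j_r}`, `J = (j₁, …, j_r)`. -/
def totalDList (k : ℕ) : (J : List (Fin p)) → GTau (Jet p q k) ℝ →
    GTau (Jet p q (k + J.length)) ℝ
  | [], f => f
  | i :: J, f => totalD (k + J.length) i (totalDList k J f)

/-- The characteristic `ψ_α - ∑ ξ_i u_i^α`, a generalized function of `1`-jets. -/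
def characteristic (ξ : Fin p → GTau (Fin p → ℝ) ℝ)
    (ψ : Fin q → GTau ((Fin p → ℝ) × (Fin q → ℝ)) ℝ) (α : Fin q) : GTau (Jet p q 1) ℝ :=
  GTau.pull (jetXU p q 1) (ψ α) - ∑ i, GTau.pull (jetX p q 1) (ξ i) *
    ofLin R0 (jetU p q (MultiIdx.ofList [i] le_rfl) α)

/-- The expression `D_J(ψ_α - ∑ ξ_i u_i^α) + ∑ ξ_i u_{J,i}^α` for `J = (j₁, …, j_k)`, as a
generalized function of `(k+1)`-jets. -/
def prolongCoeff (ξ : Fin p → GTau (Fin p → ℝ) ℝ)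
    (ψ : Fin q → GTau ((Fin p → ℝ) × (Fin q → ℝ)) ℝ) (α : Fin q) (J : List (Fin p)) :
    GTau (Jet p q (1 + J.length)) ℝ :=
  totalDList 1 J (characteristic ξ ψ α) +
    ∑ i, GTau.pull (jetX p q (1 + J.length)) (ξ i) *
      ofLin R0 (jetU p q (MultiIdx.ofList (i :: J) (by simp [add_comm])) α)

end Prolongation

end Colombeau
end

open Colombeau

/-! The proof differentiates the transformed graph u = h(x) at η = 0, for one ε at a time. As Φ(0,
·) = id holds only up to a negligible net, representatives of Ξ and Ψ are corrected so that Ξ_ε(0,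
x) = x and Ψ_ε(0, (x, u)) = u hold exactly (`ProjAction.exists_rep`). The coefficients ξ_i and ψ_α
are then represented by the η-derivatives at 0 (`rep_of_generator`), every object in the theorem has
an explicit representative, and what remains for each ε is a classical identity between smooth
functions.

For smooth h, the η-derivative at 0 of Ψ_η(Ξ_{-η}(y), h(Ξ_{-η}(y))) is the characteristic Q = ψ(y,
h) - ∑ ξ_i ∂_i h; the minus sign comes from Ξ_{-η} (`dirD_actFun`). The J-coordinate of the
prolonged action is ∂^J of the transformed function, taken at the moving point Ξ_η(x). Its
η-derivative has two parts: ∂_η commutes with ∂^J and gives ∂^J Q(x), and the motion of the base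
point gives ∑ ξ_i ∂_i ∂^J h(x) (`dirD_prolong`). Along the jets of h the total derivative D_i
becomes ∂_i (`totalDFun_jetOf`), so the sum of both parts is the asserted formula, evaluated on the
jet of h (`prolongCoeffFun_jetOf`).

One gap remains: the prolonged action uses a Taylor polynomial of degree at most n, whose
derivatives of order n + 1 vanish, whereas the formula is read at an arbitrary (n+1)-jet. The terms
of order |J| + 1 cancel, because ψ^{(j,J)} = D_j ψ^J - ∑ (∂_j ξ_i) u_{J,i}. So ψ^J depends on the
|J|-jet only (`exists_coeffAlong_eq`), and both readings agree (`coeffAlong_taylorPoly`). -/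

noncomputable section

namespace Colombeau

/-! ### Calculus of representatives of generalized functions. -/

section Representatives

variable {P E P' E' F F' : Type} [NormedAddCommGroup P] [NormedSpace ℝ P]
  [NormedAddCommGroup E] [NormedSpace ℝ E] [NormedAddCommGroup P'] [NormedSpace ℝ P']
  [NormedAddCommGroup E'] [NormedSpace ℝ E'] [NormedAddCommGroup F] [NormedSpace ℝ F]
  [NormedAddCommGroup F'] [NormedSpace ℝ F']

/-- The moderate net `u` represents the generalized function `U`. -/
def Rep (U : GMixed P E F) (u : Eps → P × E → F) : Prop :=
  ∃ hu : IsModerate u, U = GMixed.mk u hu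

/-- The derivative of `f` in the direction of the constant vector `v`. -/
def dirD {V W : Type} [NormedAddCommGroup V] [NormedSpace ℝ V] [NormedAddCommGroup W]
    [NormedSpace ℝ W] (v : V) (f : V → W) : V → W := fun x => fderiv ℝ f x v

theorem exists_rep (U : GMixed P E F) : ∃ u, Rep U u := by
  induction U using QuotientAddGroup.induction_on with
  | _ a => exact ⟨a.1, a.2, rfl⟩

namespace Rep

variable {U U' : GMixed P E F} {u u' : Eps → P × E → F}

theorem contDiff (h : Rep U u) (ε : Eps) : ContDiff ℝ ∞ (u ε) := (h.1.1 ε).1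

/-- The identities of the theorem are derived from this: one net is exhibited that represents both
sides, so that no difference has to be estimated. -/
theorem unique (h : Rep U u) (h' : Rep U' u) : U = U' := by
  obtain ⟨hu, rfl⟩ := h
  obtain ⟨hu', rfl⟩ := h'
  rfl

theorem congr (h : Rep U u) (e : ∀ ε s y, u ε (s, y) = u' ε (s, y)) : Rep U u' := by
  have : u = u' := by
    ext1 ε
    ext1 ⟨s, y⟩
    exact e ε s y
  exact this ▸ h

theorem zero : Rep (0 : GMixed P E F) (fun _ _ => 0) :=
  ⟨IsNegligible.zero.isModerate, rfl⟩

theorem add (h : Rep U u) (h' : Rep U' u') : Rep (U + U') (fun ε x => u ε x + u' ε x) := by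
  obtain ⟨hu, rfl⟩ := h
  obtain ⟨hu', rfl⟩ := h'
  exact ⟨hu.add hu', rfl⟩

theorem neg (h : Rep U u) : Rep (-U) (fun ε x => -u ε x) := by
  obtain ⟨hu, rfl⟩ := h
  exact ⟨hu.neg, rfl⟩

theorem sub (h : Rep U u) (h' : Rep U' u') : Rep (U - U') (fun ε x => u ε x - u' ε x) := by
  simpa only [sub_eq_add_neg] using h.add h'.neg

theorem sum {ι : Type} (t : Finset ι) {U : ι → GMixed P E F} {u : ι → Eps → P × E → F}
    (h : ∀ i, Rep (U i) (u i)) : Rep (∑ i ∈ t, U i) (fun ε x => ∑ i ∈ t, u i ε x) := by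
  classical
  induction t using Finset.induction_on with
  | empty => simpa using zero
  | insert i t hi ih => simpa only [Finset.sum_insert hi] using (h i).add ih

theorem comp {h : P' → P} (hh : ContDiff ℝ ∞ h) {V : GMixed P' E' E} {v : Eps → P' × E' → E}
    (hu : Rep U u) (hv : Rep V v) :
    Rep (GMixed.comp h hh U V) (fun ε x => u ε (h x.1, v ε x)) := by
  obtain ⟨hu, rfl⟩ := hu
  obtain ⟨hv, rfl⟩ := hv
  exact ⟨hu.comp hh hv, rfl⟩

theorem fderiv (h : Rep U u) : Rep U.fderiv (fun ε => _root_.fderiv ℝ (u ε)) := by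
  obtain ⟨hu, rfl⟩ := h
  exact ⟨hu.fderiv, rfl⟩

theorem ofSlow {f : E → F} (hf : f.HasTemperateGrowth) :
    Rep (ofSlow P f hf) (fun _ x => f x.2) := ⟨isModerate_const P hf, rfl⟩

theorem ofLin (A : E →L[ℝ] F) : Rep (ofLin P A) (fun _ x => A x.2) := ofSlow _

theorem proj : Rep (proj P E) (fun _ x => x.2) := ofLin (P := P) (ContinuousLinearMap.id ℝ E)

theorem gtauComp {U : GTau E F} {u : Eps → R0 × E → F} {V : GMixed P' E' E}
    {v : Eps → P' × E' → E} (hu : Rep U u) (hv : Rep V v) :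
    Rep (GTau.comp U V) (fun ε x => u ε (0, v ε x)) := comp _ hu hv

theorem lin (A : F →L[ℝ] F') (h : Rep U u) : Rep (U.lin A) (fun ε x => A (u ε x)) :=
  gtauComp (ofLin A) h

theorem insert {V : GMixed P E' E} {v : Eps → P × E' → E} (hu : Rep U u) (hv : Rep V v) :
    Rep (U.insert V) (fun ε x => u ε (x.1, v ε x)) := comp _ hu hv

theorem pull {U : GTau E F} {u : Eps → R0 × E → F} (A : E' →L[ℝ] E) (hu : Rep U u) :
    Rep (GTau.pull A U) (fun ε x => u ε (0, A x.2)) := gtauComp hu (ofLin A)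

theorem atParam (s₀ : P) (hu : Rep U u) : Rep (U.atParam s₀) (fun ε x => u ε (s₀, x.2)) :=
  comp _ hu proj

theorem pair {V : GMixed P E F'} {v : Eps → P × E → F'} (hu : Rep U u) (hv : Rep V v) :
    Rep (U.pair V) (fun ε x => (u ε x, v ε x)) :=
  ((hu.lin _).add (hv.lin _)).congr fun ε s y => by simp

theorem tuple {ι : Type} [Fintype ι] [DecidableEq ι] {U : ι → GMixed P E F}
    {u : ι → Eps → P × E → F} (h : ∀ i, Rep (U i) (u i)) :
    Rep (GMixed.tuple U) (fun ε x i => u i ε x) :=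
  (sum Finset.univ fun i => (h i).lin _).congr fun ε s y => by
    ext i
    simp [Finset.sum_apply, Pi.single_apply]

theorem mul {U V : GMixed P E ℝ} {u v : Eps → P × E → ℝ} (hu : Rep U u) (hv : Rep V v) :
    Rep (U * V) (fun ε x => u ε x * v ε x) :=
  gtauComp (ofSlow mul_hasTemperateGrowth) (hu.pair hv)

theorem dirDeriv (v : P × E) (hu : Rep U u) : Rep (U.dirDeriv v) (fun ε => dirD v (u ε)) :=
  hu.fderiv.lin _

/-- The parameter space `R0` is a single point, so a derivative on `R0 × E` in the direction (0, v)
is a derivative of the slice at 0. In this form the classical lemmas on functions of y alone apply.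
-/
theorem gtauDirDeriv {U : GTau E F} {u : Eps → R0 × E → F} (v : E) (hu : Rep U u) :
    Rep (GTau.dirDeriv v U) (fun ε x => dirD v (fun y => u ε (0, y)) x.2) := by
  refine (hu.dirDeriv (0, v)).congr fun ε s y => ?_
  obtain rfl := Subsingleton.elim s 0
  have h1 : HasFDerivAt (fun y : E => ((0 : R0), y)) (ContinuousLinearMap.inr ℝ R0 E) y :=
    (ContinuousLinearMap.inr ℝ R0 E).hasFDerivAt
  have h2 := (((hu.contDiff ε).differentiable (by simp) (0, y)).hasFDerivAt.comp y h1).fderiv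
  change _ = _root_.fderiv ℝ (u ε ∘ fun y : E => ((0 : R0), y)) y v
  rw [h2]
  rfl

theorem vec {f : GTau E ℝ} {u : Eps → R0 × E → ℝ} (hu : Rep f u) (v : E) :
    Rep (GTau.vec f v) (fun ε x => u ε x • v) := hu.lin _

theorem generator {Φ : GMixed ℝ E E} {u : Eps → ℝ × E → E} (hu : Rep Φ u) :
    Rep (generator Φ) (fun ε x => dirD ((1 : ℝ), (0 : E)) (u ε) (0, x.2)) :=
  (hu.dirDeriv _).atParam 0

end Rep

/-- A generalized function with linear restriction to `η = 0` has a representative all of whose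
members restrict to that linear map. -/
theorem exists_rep_of_atParam_zero {U : GMixed ℝ E F} {A : E →L[ℝ] F}
    (h : U.atParam 0 = ofLin R0 A) : ∃ u, Rep U u ∧ ∀ ε y, u ε (0, y) = A y := by
  obtain ⟨v, hv⟩ := exists_rep U
  -- The error v(0, y) - A y, extended independently of η, is subtracted from v. Its class is zero,
  -- so the corrected net still represents U, and at η = 0 exactly A y is left.
  have h1 := hv.sub (Rep.comp (h := fun _ : ℝ => (0 : R0)) contDiff_const
    ((hv.atParam 0).sub (Rep.ofLin A)) (Rep.proj (P := ℝ) (E := E)))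
  have h2 : GMixed.comp (fun _ : ℝ => (0 : R0)) contDiff_const (0 : GMixed R0 E F) (proj ℝ E) = 0 :=
    (Rep.comp contDiff_const Rep.zero Rep.proj).unique Rep.zero
  rw [h, sub_self, h2, sub_zero] at h1
  exact ⟨_, h1, fun ε y => by simp⟩

end Representatives

/-! ### Iterated directional derivatives of smooth maps. -/

section DirectionalDerivatives

variable {V V' W W' : Type} [NormedAddCommGroup V] [NormedSpace ℝ V] [NormedAddCommGroup W]
  [NormedSpace ℝ W] [NormedAddCommGroup V'] [NormedSpace ℝ V'] [NormedAddCommGroup W']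
  [NormedSpace ℝ W']

/-- The iterated directional derivative `∂_{v₁} ⋯ ∂_{v_r} f`. -/
def dirDs (L : List V) (f : V → W) : V → W := L.foldr dirD f

theorem dirDs_cons (v : V) (L : List V) (f : V → W) : dirDs (v :: L) f = dirD v (dirDs L f) := rfl

theorem dirDs_append (L L' : List V) (f : V → W) : dirDs (L ++ L') f = dirDs L (dirDs L' f) :=
  List.foldr_append

theorem contDiff_dirD {f : V → W} (hf : ContDiff ℝ ∞ f) (v : V) : ContDiff ℝ ∞ (dirD v f) :=
  (hf.fderiv_right (m := ∞) (by simp)).clm_apply contDiff_const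

theorem contDiff_dirDs {f : V → W} (hf : ContDiff ℝ ∞ f) (L : List V) :
    ContDiff ℝ ∞ (dirDs L f) := by
  induction L with
  | nil => exact hf
  | cons v L ih => exact contDiff_dirD ih v

/-- For constant directions both sides are values of the second derivative, which is symmetric. -/
theorem dirD_comm {f : V → W} (hf : ContDiff ℝ ∞ f) (v w : V) :
    dirD v (dirD w f) = dirD w (dirD v f) := by
  have hd : Differentiable ℝ (fderiv ℝ f) :=
    (hf.fderiv_right (m := ∞) (by simp)).differentiable (by simp)
  have key : ∀ (a b x : V), dirD a (dirD b f) x = fderiv ℝ (fderiv ℝ f) x a b := fun a b x => by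
    have := ((ContinuousLinearMap.apply ℝ W b).hasFDerivAt.comp x (hd x).hasFDerivAt).fderiv
    change fderiv ℝ (ContinuousLinearMap.apply ℝ W b ∘ fderiv ℝ f) x a = _
    rw [this]
    rfl
  ext1 x
  rw [key, key]
  exact (hf.contDiffAt.isSymmSndFDerivAt (by
    rw [minSmoothness_of_isRCLikeNormedField]; exact WithTop.coe_le_coe.2 (le_top : (2 : ℕ∞) ≤ ⊤))) v w

/-- This serves two purposes: derivatives indexed by tuples depend on the multi-index only, and ∂_η
may be moved past the derivatives in y. -/
theorem dirDs_perm {f : V → W} (hf : ContDiff ℝ ∞ f) {L L' : List V} (h : L.Perm L') :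
    dirDs L f = dirDs L' f := by
  induction h with
  | nil => rfl
  | cons v _ ih => rw [dirDs_cons, dirDs_cons, ih]
  | swap v w L => exact dirD_comm (contDiff_dirDs hf L) w v
  | trans _ _ ih ih' => exact ih.trans ih'

theorem dirD_clm {f : V → W} (hf : ContDiff ℝ ∞ f) (A : W →L[ℝ] W') (v : V) :
    dirD v (fun x => A (f x)) = fun x => A (dirD v f x) := by
  ext1 x
  have := (A.hasFDerivAt.comp x (hf.differentiable (by simp) x).hasFDerivAt).fderiv
  change fderiv ℝ (A ∘ f) x v = _
  rw [this]
  rfl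

theorem dirDs_clm {f : V → W} (hf : ContDiff ℝ ∞ f) (A : W →L[ℝ] W') (L : List V) :
    dirDs L (fun x => A (f x)) = fun x => A (dirDs L f x) := by
  induction L with
  | nil => rfl
  | cons v L ih => rw [dirDs_cons, ih, dirD_clm (contDiff_dirDs hf L), dirDs_cons]

theorem dirD_affine {f : V → W} (hf : ContDiff ℝ ∞ f) (B : V' →L[ℝ] V) (c : V) (v : V') :
    dirD v (fun x => f (c + B x)) = fun x => dirD (B v) f (c + B x) := by
  ext1 x
  have h1 : HasFDerivAt (fun x => c + B x) B x := B.hasFDerivAt.const_add c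
  have := ((hf.differentiable (by simp) (c + B x)).hasFDerivAt.comp x h1).fderiv
  change fderiv ℝ (f ∘ fun x => c + B x) x v = _
  rw [this]
  rfl

/-- An affine map has constant derivative, so no higher chain rule terms appear. The application is
to the slice of (η, z, y)-space with η = 0 and z fixed. -/
theorem dirDs_affine {f : V → W} (hf : ContDiff ℝ ∞ f) (B : V' →L[ℝ] V) (c : V) (L : List V') :
    dirDs L (fun x => f (c + B x)) = fun x => dirDs (L.map B) f (c + B x) := by
  induction L with
  | nil => rfl
  | cons v L ih =>
    rw [dirDs_cons, ih, dirD_affine (contDiff_dirDs hf _), List.map_cons, dirDs_cons]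

theorem dirD_mul {f g : V → ℝ} (hf : ContDiff ℝ ∞ f) (hg : ContDiff ℝ ∞ g) (v x : V) :
    dirD v (fun x => f x * g x) x = f x * dirD v g x + dirD v f x * g x := by
  have := ((hf.differentiable (by simp) x).hasFDerivAt.mul
    (hg.differentiable (by simp) x).hasFDerivAt).fderiv
  change fderiv ℝ (f * g) x v = _
  rw [this]
  simp [dirD]
  ring

theorem dirD_sub {f g : V → W} (hf : ContDiff ℝ ∞ f) (hg : ContDiff ℝ ∞ g) (v x : V) :
    dirD v (fun x => f x - g x) x = dirD v f x - dirD v g x := by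
  unfold dirD
  rw [fderiv_fun_sub (hf.differentiable (by simp) x) (hg.differentiable (by simp) x)]
  rfl

theorem dirD_sum {ι : Type} (t : Finset ι) {f : ι → V → W} (hf : ∀ i, ContDiff ℝ ∞ (f i))
    (v x : V) : dirD v (fun x => ∑ i ∈ t, f i x) x = ∑ i ∈ t, dirD v (f i) x := by
  unfold dirD
  rw [fderiv_fun_sum fun i _ => (hf i).differentiable (by simp) x]
  simp

theorem dirD_eq_deriv {f : V → W} (hf : ContDiff ℝ ∞ f) (v x : V) :
    dirD v f x = deriv (fun t : ℝ => f (x + t • v)) 0 :=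
  ((hf.differentiable (by simp) x).lineDeriv_eq_fderiv (v := v)).symm

end DirectionalDerivatives

/-! ### Jets of functions and total derivatives. -/

section PartialDerivatives

variable {p q : ℕ} {W W' : Type} [NormedAddCommGroup W] [NormedSpace ℝ W] [NormedAddCommGroup W']
  [NormedSpace ℝ W']

/-- The iterated partial derivative `∂_{j₁} ⋯ ∂_{j_r} f`. -/
def partialDs (J : List (Fin p)) (f : (Fin p → ℝ) → W) : (Fin p → ℝ) → W :=
  dirDs (J.map fun i => Pi.single i 1) f

theorem partialDs_cons (i : Fin p) (J : List (Fin p)) (f : (Fin p → ℝ) → W) :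
    partialDs (i :: J) f = dirD (Pi.single i 1) (partialDs J f) := rfl

theorem contDiff_partialDs {f : (Fin p → ℝ) → W} (hf : ContDiff ℝ ∞ f) (J : List (Fin p)) :
    ContDiff ℝ ∞ (partialDs J f) := contDiff_dirDs hf _

theorem partialDs_perm {f : (Fin p → ℝ) → W} (hf : ContDiff ℝ ∞ f) {J J' : List (Fin p)}
    (h : J.Perm J') : partialDs J f = partialDs J' f := dirDs_perm hf (h.map _)

/-- The non-decreasing tuple with a given multi-index. -/
def multiList (J : Fin p → ℕ) : List (Fin p) :=
  (List.finRange p).flatMap fun i => List.replicate (J i) i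

theorem count_multiList (J : Fin p → ℕ) (i : Fin p) : (multiList J).count i = J i := by
  rw [multiList, List.count_flatMap, ← List.ofFn_eq_map, List.sum_ofFn]
  simp [List.count_replicate]

theorem multiList_perm {J : Fin p → ℕ} {L : List (Fin p)} (h : ∀ i, L.count i = J i) :
    (multiList J).Perm L :=
  List.perm_iff_count.2 fun i => by rw [count_multiList, h]

/-- The `k`-jet of `h` as a function of the point. -/
def jetOf (k : ℕ) (h : (Fin p → ℝ) → Fin q → ℝ) (x : Fin p → ℝ) : Jet p q k :=
  (x, fun J => partialDs (multiList J.1) h x)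

theorem contDiff_jetOf {h : (Fin p → ℝ) → Fin q → ℝ} (hh : ContDiff ℝ ∞ h) (k : ℕ) :
    ContDiff ℝ ∞ (jetOf k h) :=
  contDiff_id.prodMk (contDiff_pi.2 fun _ => contDiff_partialDs hh _)

theorem jetForget_jetOf {m n : ℕ} (hmn : m ≤ n) (h : (Fin p → ℝ) → Fin q → ℝ)
    (x : Fin p → ℝ) : jetForget p q hmn (jetOf n h x) = jetOf m h x := rfl

theorem jetOf_ofList {h : (Fin p → ℝ) → Fin q → ℝ} (hh : ContDiff ℝ ∞ h) {k : ℕ}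
    (L : List (Fin p)) (hL : L.length ≤ k) (x : Fin p → ℝ) :
    (jetOf k h x).2 (MultiIdx.ofList L hL) = partialDs L h x :=
  congrFun (partialDs_perm hh (multiList_perm fun _ => rfl)) x

theorem jetOf_zero {h : (Fin p → ℝ) → Fin q → ℝ} (hh : ContDiff ℝ ∞ h) {k : ℕ}
    (x : Fin p → ℝ) : (jetOf k h x).2 (MultiIdx.zero p k) = h x :=
  congrFun (partialDs_perm hh (J' := []) (multiList_perm fun _ => rfl)) x

theorem jetOf_succ {h : (Fin p → ℝ) → Fin q → ℝ} (hh : ContDiff ℝ ∞ h) {k : ℕ}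
    (J : MultiIdx p k) (i : Fin p) (x : Fin p → ℝ) :
    (jetOf (k + 1) h x).2 (J.succ i) =
      dirD (Pi.single i 1) (partialDs (multiList J.1) h) x := by
  refine congrFun (partialDs_perm hh (J' := i :: multiList J.1) (multiList_perm fun j => ?_)) x
  rw [List.count_cons, count_multiList]
  by_cases hij : i = j
  · simp [MultiIdx.succ, hij]
  · simp [MultiIdx.succ, hij]

/-- The total derivative of a smooth function of `k`-jets. -/
def totalDFun (k : ℕ) (i : Fin p) (f : Jet p q k → ℝ) (w : Jet p q (k + 1)) : ℝ :=
  dirD (jetDx p q k i) f (jetForget p q k.le_succ w) +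
    ∑ β, ∑ J : MultiIdx p k, jetU p q (J.succ i) β w *
      dirD (jetDu p q J β) f (jetForget p q k.le_succ w)

/-- The iterated total derivative of a smooth function of `k`-jets. -/
def totalDListFun (k : ℕ) : (J : List (Fin p)) → (Jet p q k → ℝ) → Jet p q (k + J.length) → ℝ
  | [], f => f
  | i :: J, f => totalDFun (k + J.length) i (totalDListFun k J f)

theorem contDiff_totalDFun {k : ℕ} (i : Fin p) {f : Jet p q k → ℝ} (hf : ContDiff ℝ ∞ f) :
    ContDiff ℝ ∞ (totalDFun k i f) := by
  have h : ∀ v, ContDiff ℝ ∞ fun w => dirD v f (jetForget p q k.le_succ w) := fun v =>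
    (contDiff_dirD hf v).comp (jetForget p q k.le_succ).contDiff
  exact (h _).add (ContDiff.sum fun β _ => ContDiff.sum fun J _ =>
    (jetU p q (J.succ i) β).contDiff.mul (h _))

theorem contDiff_totalDListFun {k : ℕ} (J : List (Fin p)) {f : Jet p q k → ℝ}
    (hf : ContDiff ℝ ∞ f) : ContDiff ℝ ∞ (totalDListFun k J f) := by
  induction J with
  | nil => exact hf
  | cons i J ih => exact contDiff_totalDFun i ih

/-- This is the chain rule, and the reason for the shape of D_i: the coefficients u_{K,i} of the
(k+1)-jet are the x_i-derivatives of the coordinates u_K of the k-jet. -/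
theorem totalDFun_jetOf {h : (Fin p → ℝ) → Fin q → ℝ} (hh : ContDiff ℝ ∞ h) {k : ℕ}
    (i : Fin p) {f : Jet p q k → ℝ} (hf : ContDiff ℝ ∞ f) (x : Fin p → ℝ) :
    totalDFun k i f (jetOf (k + 1) h x) =
      dirD (Pi.single i 1) (fun y => f (jetOf k h y)) x := by
  have h1 : HasFDerivAt (jetOf k h) ((ContinuousLinearMap.id ℝ (Fin p → ℝ)).prod
      (ContinuousLinearMap.pi fun J : MultiIdx p k =>
        fderiv ℝ (partialDs (multiList J.1) h) x)) x :=
    (hasFDerivAt_id x).prodMk (hasFDerivAt_pi.2 fun J =>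
      ((contDiff_partialDs hh _).differentiable (by simp) x).hasFDerivAt)
  have h2 := ((hf.differentiable (by simp) (jetOf k h x)).hasFDerivAt.comp x h1).fderiv
  change _ = fderiv ℝ (f ∘ jetOf k h) x (Pi.single i 1)
  rw [h2, ContinuousLinearMap.comp_apply]
  -- The velocity of x ↦ j^k h(x) in the direction x_i, expanded in the coordinate directions of the
  -- jet space.
  have h3 : ((ContinuousLinearMap.id ℝ (Fin p → ℝ)).prod
      (ContinuousLinearMap.pi fun J : MultiIdx p k =>
        fderiv ℝ (partialDs (multiList J.1) h) x)) (Pi.single i 1) =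
      jetDx p q k i + ∑ β, ∑ J : MultiIdx p k,
        jetU p q (J.succ i) β (jetOf (k + 1) h x) • jetDu p q J β := by
    have h4 : ∀ (J : MultiIdx p k) β, jetU p q (J.succ i) β (jetOf (k + 1) h x) =
        fderiv ℝ (partialDs (multiList J.1) h) x (Pi.single i 1) β := fun J β =>
      congrFun (jetOf_succ hh J i x) β
    simp only [h4]
    refine Prod.ext ?_ ?_
    · simp [jetDx, jetDu, Prod.fst_sum]
    · ext J β
      simp [jetDx, jetDu, Prod.snd_sum, Finset.sum_apply, Pi.single_apply]
  rw [h3, map_add, map_sum]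
  simp only [map_sum, map_smul, smul_eq_mul]
  rfl

theorem totalDListFun_jetOf {h : (Fin p → ℝ) → Fin q → ℝ} (hh : ContDiff ℝ ∞ h) {k : ℕ}
    (J : List (Fin p)) {f : Jet p q k → ℝ} (hf : ContDiff ℝ ∞ f) (x : Fin p → ℝ) :
    totalDListFun k J f (jetOf (k + J.length) h x) =
      partialDs J (fun y => f (jetOf k h y)) x := by
  induction J generalizing x with
  | nil => rfl
  | cons i J ih =>
    refine (totalDFun_jetOf hh i (contDiff_totalDListFun J hf) x).trans ?_
    rw [partialDs_cons, funext ih]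

end PartialDerivatives

/-! ### The Taylor polynomial realizes a prescribed jet. -/

section Taylor

variable {p q : ℕ}

/-- The function is the c-th derivative of t^k / k!. Since subtraction in ℕ truncates, the vanishing
for c > k has to be stated as a separate branch; c = k is the passage from the constant 1 to it. -/
theorem deriv_divided_power (k c : ℕ) (t : ℝ) :
    HasDerivAt (fun t : ℝ => if c ≤ k then t ^ (k - c) / ((k - c).factorial : ℝ) else 0)
      (if c + 1 ≤ k then t ^ (k - (c + 1)) / ((k - (c + 1)).factorial : ℝ) else 0) t := by
  rcases lt_trichotomy c k with h | rfl | h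
  · obtain ⟨m, rfl⟩ := Nat.exists_eq_add_of_lt h
    have h1 : c + m + 1 - c = m + 1 := by omega
    have h2 : c + m + 1 - (c + 1) = m := by omega
    simp only [h1, h2, if_pos (show c ≤ c + m + 1 by omega),
      if_pos (show c + 1 ≤ c + m + 1 by omega)]
    refine ((hasDerivAt_pow (m + 1) t).div_const _).congr_deriv ?_
    rw [Nat.factorial_succ]
    have := Nat.factorial_ne_zero m
    push_cast
    field_simp
  · simpa using hasDerivAt_const t (1 : ℝ)
  · simp only [if_neg (show ¬ c ≤ k by omega), if_neg (show ¬ c + 1 ≤ k by omega)]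
    exact hasDerivAt_const t 0

/-- The derivative `∂_L` of the divided power `t^J / J!`. -/
def dividedPower (L : List (Fin p)) (J : Fin p → ℕ) (t : Fin p → ℝ) : ℝ :=
  ∏ i, if L.count i ≤ J i then t i ^ (J i - L.count i) / ((J i - L.count i).factorial : ℝ) else 0

theorem contDiff_dividedPower (L : List (Fin p)) (J : Fin p → ℕ) :
    ContDiff ℝ ∞ (dividedPower L J) := by
  refine contDiff_prod fun i _ => ?_
  split_ifs
  · exact ((contDiff_apply ℝ ℝ i).pow _).div_const _
  · exact contDiff_const

/-- Only the j-th factor varies along the j-th coordinate direction, so the rule in one variable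
suffices. -/
theorem dirD_dividedPower (L : List (Fin p)) (J : Fin p → ℕ) (j : Fin p) :
    dirD (Pi.single j 1) (dividedPower L J) = dividedPower (j :: L) J := by
  ext1 t
  rw [dirD_eq_deriv (contDiff_dividedPower L J)]
  have h1 := (HasDerivAt.comp_const_add (t j) 0 (by
    simpa using deriv_divided_power (J j) (L.count j) (t j))).mul_const
    (∏ i ∈ Finset.univ.erase j, if L.count i ≤ J i then
      t i ^ (J i - L.count i) / ((J i - L.count i).factorial : ℝ) else 0)
  have h2 : (fun s : ℝ => dividedPower L J (t + s • Pi.single j 1)) = fun s =>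
      (if L.count j ≤ J j then
        (t j + s) ^ (J j - L.count j) / ((J j - L.count j).factorial : ℝ) else 0) *
      ∏ i ∈ Finset.univ.erase j, if L.count i ≤ J i then
        t i ^ (J i - L.count i) / ((J i - L.count i).factorial : ℝ) else 0 := by
    ext1 s
    rw [dividedPower, ← Finset.mul_prod_erase _ _ (Finset.mem_univ j)]
    congr 1
    · simp
    · refine Finset.prod_congr rfl fun i hi => ?_
      simp [Pi.single_eq_of_ne (Finset.ne_of_mem_erase hi)]
  rw [h2, h1.deriv, dividedPower, ← Finset.mul_prod_erase _ _ (Finset.mem_univ j),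
    List.count_cons_self]
  congr 1
  refine Finset.prod_congr rfl fun i hi => ?_
  rw [List.count_cons_of_ne (Finset.ne_of_mem_erase hi).symm]

theorem partialDs_taylorPoly {m : ℕ} (w : Jet p q m) (L : List (Fin p)) :
    partialDs L (fun y => taylorPoly p q m (w, y)) = fun y =>
      ∑ J : MultiIdx p m, dividedPower L J.1 (-w.1 + y) • w.2 J := by
  induction L with
  | nil =>
    ext1 y
    refine Finset.sum_congr rfl fun J _ => ?_
    simp [dividedPower, sub_eq_neg_add]
  | cons j L ih =>
    rw [partialDs_cons, ih]
    ext1 y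
    have hc : ∀ J : MultiIdx p m, ContDiff ℝ ∞ fun y => dividedPower L J.1 (-w.1 + y) :=
      fun J => (contDiff_dividedPower L J.1).comp (contDiff_const.add contDiff_id)
    have hs : ∀ J : MultiIdx p m, ContDiff ℝ ∞ fun y => dividedPower L J.1 (-w.1 + y) • w.2 J :=
      fun J => (hc J).smul contDiff_const
    rw [dirD_sum _ hs]
    refine Finset.sum_congr rfl fun J _ => ?_
    have h1 := congrFun (dirD_clm (hc J) (ContinuousLinearMap.toSpanSingleton ℝ (w.2 J))
      (Pi.single j 1)) y
    have h2 := congrFun (dirD_affine (contDiff_dividedPower L J.1)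
      (ContinuousLinearMap.id ℝ (Fin p → ℝ)) (-w.1) (Pi.single j 1)) y
    simp only [ContinuousLinearMap.toSpanSingleton_apply, ContinuousLinearMap.id_apply] at h1 h2
    rw [h1, h2, dirD_dividedPower]

/-- If J and K differ in the entry i, the i-th factor vanishes: for K_i > J_i too many derivatives
are taken, and for K_i < J_i a positive power of 0 is left. -/
theorem dividedPower_zero {m : ℕ} (K J : MultiIdx p m) :
    dividedPower (multiList K.1) J.1 0 = if J = K then 1 else 0 := by
  unfold dividedPower
  simp only [count_multiList]
  split_ifs with h
  · subst h
    simp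
  · obtain ⟨i, hi⟩ : ∃ i, J.1 i ≠ K.1 i := by
      by_contra! h'
      exact h (Subtype.ext (funext h'))
    refine Finset.prod_eq_zero (Finset.mem_univ i) ?_
    split_ifs with h'
    · simp [zero_pow (show J.1 i - K.1 i ≠ 0 by omega)]
    · rfl

/-- The `m`-jet of the Taylor polynomial `h_w` at the base point of `w` is `w`. -/
theorem jetOf_taylorPoly {m : ℕ} (w : Jet p q m) :
    jetOf m (fun y => taylorPoly p q m (w, y)) w.1 = w := by
  refine Prod.ext rfl (funext fun K => ?_)
  change partialDs _ _ _ = _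
  rw [partialDs_taylorPoly]
  simp [dividedPower_zero, ite_smul]

end Taylor

/-! ### The characteristic and the order of the prolongation coefficients. -/

section Characteristic

variable {p q : ℕ}

/-- The characteristic `ψ(y, h(y)) - ∑ ξ_i(y) ∂_i h^α(y)` evaluated along a function `h`. -/
def charAlong (ξ : Fin p → (Fin p → ℝ) → ℝ) (ψ : (Fin p → ℝ) × (Fin q → ℝ) → ℝ) (α : Fin q)
    (h : (Fin p → ℝ) → Fin q → ℝ) (y : Fin p → ℝ) : ℝ :=
  ψ (y, h y) - ∑ i, ξ i y * partialDs [i] h y α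

/-- The value of the coefficient `ψ_α^J` along a function `h`. -/
def coeffAlong (ξ : Fin p → (Fin p → ℝ) → ℝ) (ψ : (Fin p → ℝ) × (Fin q → ℝ) → ℝ) (α : Fin q)
    (J : List (Fin p)) (h : (Fin p → ℝ) → Fin q → ℝ) (x : Fin p → ℝ) : ℝ :=
  partialDs J (charAlong ξ ψ α h) x + ∑ i, ξ i x * partialDs (i :: J) h x α

/-- The coefficient `ψ_α^J` of the prolongation depends on the `|J|`-jet only. -/
theorem exists_coeffAlong_eq {ξ : Fin p → (Fin p → ℝ) → ℝ} (hξ : ∀ i, ContDiff ℝ ∞ (ξ i))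
    {ψ : (Fin p → ℝ) × (Fin q → ℝ) → ℝ} (hψ : ContDiff ℝ ∞ ψ) (α : Fin q) (J : List (Fin p)) :
    ∃ G : Jet p q J.length → ℝ, ContDiff ℝ ∞ G ∧ ∀ h : (Fin p → ℝ) → Fin q → ℝ,
      ContDiff ℝ ∞ h → ∀ x, coeffAlong ξ ψ α J h x = G (jetOf J.length h x) := by
  induction J with
  | nil =>
    refine ⟨fun z => ψ (jetXU p q 0 z), hψ.comp (jetXU p q 0).contDiff, fun h hh x => ?_⟩
    have e : jetXU p q 0 (jetOf 0 h x) = (x, h x) := Prod.ext rfl (jetOf_zero hh x)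
    change charAlong ξ ψ α h x + _ = ψ (jetXU p q 0 (jetOf 0 h x))
    rw [e, charAlong, sub_add_cancel]
  | cons j J ih =>
    obtain ⟨G, hG, H⟩ := ih
    -- The witness is the recursion ψ^{(j,J)} = D_j ψ^J - ∑ (D_j ξ_i) u_{J,i}, whose right side
    -- contains derivatives of order at most |J| + 1.
    refine ⟨fun w => totalDFun J.length j G w - ∑ i, dirD (Pi.single j 1) (ξ i) (jetX p q _ w) *
      jetU p q (MultiIdx.ofList (i :: J) le_rfl) α w, (contDiff_totalDFun j hG).sub
      (ContDiff.sum fun i _ => ((contDiff_dirD (hξ i) _).comp (jetX p q _).contDiff).mul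
        (jetU p q _ α).contDiff), fun h hh x => ?_⟩
    have hp : ∀ i, ContDiff ℝ ∞ fun x => partialDs (i :: J) h x α := fun i =>
      contDiff_pi.1 (contDiff_partialDs hh _) α
    have hGj : ContDiff ℝ ∞ fun x => G (jetOf J.length h x) := hG.comp (contDiff_jetOf hh _)
    have e1 : partialDs J (charAlong ξ ψ α h) = fun x =>
        G (jetOf J.length h x) - ∑ i, ξ i x * partialDs (i :: J) h x α := by
      ext1 x
      rw [← H h hh x, coeffAlong, add_sub_cancel_right]
    -- With ∂_i and ∂_j interchanged, the terms ξ_i ∂_i ∂_j ∂_J h of order |J| + 2 cancel against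
    -- those from the product rule.
    have e2 : ∀ i, partialDs (i :: j :: J) h x α =
        dirD (Pi.single j 1) (fun x => partialDs (i :: J) h x α) x := by
      intro i
      rw [partialDs_perm hh (List.Perm.swap j i J), partialDs_cons]
      exact (congrFun (dirD_clm (contDiff_partialDs hh (i :: J))
        (ContinuousLinearMap.proj (R := ℝ) (φ := fun _ : Fin q => ℝ) α) _) x).symm
    have e3 : ∀ i, jetU p q (MultiIdx.ofList (i :: J) le_rfl) α
        (jetOf (J.length + 1) h x) = partialDs (i :: J) h x α := fun i =>
      congrFun (jetOf_ofList hh (i :: J) le_rfl x) α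
    change partialDs (j :: J) (charAlong ξ ψ α h) x + ∑ i, ξ i x * partialDs (i :: j :: J) h x α =
      totalDFun J.length j G (jetOf (J.length + 1) h x) - ∑ i, dirD (Pi.single j 1) (ξ i) x *
        jetU p q (MultiIdx.ofList (i :: J) le_rfl) α (jetOf (J.length + 1) h x)
    rw [partialDs_cons, e1, totalDFun_jetOf hh j hG,
      dirD_sub hGj (ContDiff.sum fun i _ => (hξ i).mul (hp i)),
      dirD_sum _ fun i => (hξ i).mul (hp i)]
    simp only [e2, e3, dirD_mul (hξ _) (hp _), Finset.sum_add_distrib]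
    ring

end Characteristic

/-! ### The infinitesimal action on functions and on their derivatives. -/

section Flow

variable {p q : ℕ} {V W Z : Type} [NormedAddCommGroup V] [NormedSpace ℝ V]
  [NormedAddCommGroup W] [NormedSpace ℝ W] [NormedAddCommGroup Z] [NormedSpace ℝ Z]

theorem map_eq_sum_single (L : (Fin p → ℝ) →L[ℝ] W) (a : Fin p → ℝ) :
    L a = ∑ i, a i • L (Pi.single i 1) := by
  have h : a = ∑ i, a i • (Pi.single i 1 : Fin p → ℝ) := by
    ext j
    simp [Finset.sum_apply, Pi.single_apply]
  conv_lhs => rw [h]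
  simp

theorem hasDerivAt_fst {f : ℝ × V → W} (hf : ContDiff ℝ ∞ f) (t : ℝ) (y : V) :
    HasDerivAt (fun s => f (s, y)) (dirD ((1 : ℝ), (0 : V)) f (t, y)) t :=
  (hf.differentiable (by simp) (t, y)).hasFDerivAt.comp_hasDerivAt t
    ((hasDerivAt_id t).prodMk (hasDerivAt_const t y))

theorem fderiv_split {f : ℝ × V → W} (x : ℝ × V) (v : V) :
    fderiv ℝ f x (1, v) = dirD ((1 : ℝ), (0 : V)) f x + dirD ((0 : ℝ), v) f x := by
  rw [dirD, dirD, ← map_add]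
  simp

theorem dirD_of_restrict_eq {f : ℝ × V → W} (hf : ContDiff ℝ ∞ f) {A : V →L[ℝ] W}
    (h : ∀ y, f (0, y) = A y) (v y : V) : dirD ((0 : ℝ), v) f (0, y) = A v := by
  have h1 := congrFun (dirD_affine hf (ContinuousLinearMap.inr ℝ ℝ V) 0 v) y
  simp only [ContinuousLinearMap.inr_apply, zero_add] at h1
  rw [← h1, funext h]
  exact congrArg (fun L : V →L[ℝ] W => L v) A.fderiv

/-- The coordinate directions of `y` in the space of all `(η, z, y)`. -/
abbrev yDir (Z : Type) [NormedAddCommGroup Z] [NormedSpace ℝ Z] (i : Fin p) :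
    ℝ × (Z × (Fin p → ℝ)) := (0, (0, Pi.single i 1))

theorem dirDs_yDir {g : ℝ × (Z × (Fin p → ℝ)) → W} (hg : ContDiff ℝ ∞ g) (L : List (Fin p))
    (z : Z) (y : Fin p → ℝ) :
    dirDs (L.map (yDir Z)) g (0, (z, y)) = partialDs L (fun y => g (0, (z, y))) y := by
  have h := congrFun (dirDs_affine hg ((ContinuousLinearMap.inr ℝ ℝ (Z × (Fin p → ℝ))).comp
    (ContinuousLinearMap.inr ℝ Z (Fin p → ℝ))) (0, (z, 0)) (L.map fun i => Pi.single i 1)) y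
  simp only [List.map_map, ContinuousLinearMap.comp_apply, ContinuousLinearMap.inr_apply,
    Prod.mk_add_mk, add_zero, zero_add] at h
  exact h.symm

/-- The map `(η, z, y) ↦ Ψ_η(Ξ_{-η}(y), T(z, Ξ_{-η}(y)))`. -/
def actFun (Ξ : ℝ × (Fin p → ℝ) → Fin p → ℝ) (Ψ : ℝ × ((Fin p → ℝ) × (Fin q → ℝ)) → Fin q → ℝ)
    (T : Z × (Fin p → ℝ) → Fin q → ℝ) (x : ℝ × (Z × (Fin p → ℝ))) : Fin q → ℝ :=
  Ψ (x.1, (Ξ (-x.1, x.2.2), T (x.2.1, Ξ (-x.1, x.2.2))))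

variable {Ξ : ℝ × (Fin p → ℝ) → Fin p → ℝ} {Ψ : ℝ × ((Fin p → ℝ) × (Fin q → ℝ)) → Fin q → ℝ}
  {T : Z × (Fin p → ℝ) → Fin q → ℝ}

theorem contDiff_actFun (hΞ : ContDiff ℝ ∞ Ξ) (hΨ : ContDiff ℝ ∞ Ψ) (hT : ContDiff ℝ ∞ T) :
    ContDiff ℝ ∞ (actFun Ξ Ψ T) := by
  unfold actFun
  fun_prop

omit [NormedAddCommGroup Z] [NormedSpace ℝ Z] in
theorem actFun_zero (hΞ₀ : ∀ x, Ξ (0, x) = x) (hΨ₀ : ∀ v, Ψ (0, v) = v.2) (z : Z)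
    (y : Fin p → ℝ) : actFun Ξ Ψ T (0, (z, y)) = T (z, y) := by
  simp [actFun, hΞ₀, hΨ₀]

theorem contDiff_slice (hT : ContDiff ℝ ∞ T) (z : Z) : ContDiff ℝ ∞ fun y => T (z, y) :=
  hT.comp (contDiff_const.prodMk contDiff_id)

/-- The parameter η enters through Ψ_η and through Ξ_{-η}(y). The first dependence contributes ψ. At
η = 0 the map Ψ is the projection to u, so from the second only the velocity of T(z, Ξ_{-η}(y))
survives, which is -∑ ξ_i ∂_i T. -/
theorem dirD_actFun (hΞ : ContDiff ℝ ∞ Ξ) (hΨ : ContDiff ℝ ∞ Ψ) (hT : ContDiff ℝ ∞ T)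
    (hΞ₀ : ∀ x, Ξ (0, x) = x) (hΨ₀ : ∀ v, Ψ (0, v) = v.2) (z : Z) (y : Fin p → ℝ) (α : Fin q) :
    dirD ((1 : ℝ), (0 : Z × (Fin p → ℝ))) (actFun Ξ Ψ T) (0, (z, y)) α =
      charAlong (fun i y => dirD (1, 0) Ξ (0, y) i) (fun v => dirD (1, 0) Ψ (0, v) α) α
        (fun y => T (z, y)) y := by
  set a := dirD ((1 : ℝ), (0 : Fin p → ℝ)) Ξ (0, y)
  have h1 : HasDerivAt (fun s => Ξ (-s, y)) (-a) 0 := by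
    have h := hasDerivAt_fst hΞ (-0) y
    have := HasDerivAt.scomp (0 : ℝ) h (hasDerivAt_neg 0)
    simpa [Function.comp_def] using this
  have hTz := contDiff_slice hT z
  have h2 : HasDerivAt (fun s => T (z, Ξ (-s, y))) (fderiv ℝ (fun y => T (z, y)) y (-a)) 0 := by
    have h := (hTz.differentiable (by simp) (Ξ (-0, y))).hasFDerivAt.comp_hasDerivAt (0 : ℝ) h1
    simpa [hΞ₀, Function.comp_def] using h
  have h3 := (hΨ.differentiable (by simp) _).hasFDerivAt.comp_hasDerivAt (0 : ℝ)
    ((hasDerivAt_id (0 : ℝ)).prodMk (h1.prodMk h2))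
  rw [(hasDerivAt_fst (contDiff_actFun hΞ hΨ hT) 0 (z, y)).unique h3, fderiv_split]
  simp only [id_eq, neg_zero, hΞ₀]
  rw [dirD_of_restrict_eq hΨ (A := ContinuousLinearMap.snd ℝ _ _) hΨ₀, map_neg, map_eq_sum_single]
  simp [charAlong, Finset.sum_apply, sub_eq_add_neg]
  rfl

/-- The infinitesimal prolonged action on the coordinate with multi-index `J`. -/
theorem dirD_prolong (hΞ : ContDiff ℝ ∞ Ξ) (hΨ : ContDiff ℝ ∞ Ψ) (hT : ContDiff ℝ ∞ T)
    (hΞ₀ : ∀ x, Ξ (0, x) = x) (hΨ₀ : ∀ v, Ψ (0, v) = v.2) (A : Z →L[ℝ] (Fin p → ℝ))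
    (L : List (Fin p)) (z : Z) (α : Fin q) :
    dirD ((1 : ℝ), (0 : Z)) (fun w : ℝ × Z =>
        dirDs (L.map (yDir Z)) (actFun Ξ Ψ T) (w.1, (w.2, Ξ (w.1, A w.2)))) (0, z) α =
      coeffAlong (fun i y => dirD (1, 0) Ξ (0, y) i) (fun v => dirD (1, 0) Ψ (0, v) α) α L
        (fun y => T (z, y)) (A z) := by
  set a := dirD ((1 : ℝ), (0 : Fin p → ℝ)) Ξ (0, A z) with ha
  have hW := contDiff_actFun hΞ hΨ hT
  set g := dirDs (L.map (yDir Z)) (actFun Ξ Ψ T) with hg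
  have hgs : ContDiff ℝ ∞ g := contDiff_dirDs hW _
  have hcomp : ContDiff ℝ ∞ fun w : ℝ × Z => g (w.1, (w.2, Ξ (w.1, A w.2))) := by fun_prop
  -- The curve η ↦ (η, z, Ξ_η(A z)) has velocity (1, 0, a) at 0; `fderiv_split` separates the
  -- explicit η-dependence from the motion of the base point.
  have h3 := (hgs.differentiable (by simp) _).hasFDerivAt.comp_hasDerivAt (0 : ℝ)
    ((hasDerivAt_id (0 : ℝ)).prodMk ((hasDerivAt_const (0 : ℝ) z).prodMk
      (hasDerivAt_fst hΞ 0 (A z))))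
  rw [(hasDerivAt_fst hcomp 0 z).unique h3, fderiv_split]
  simp only [id_eq, hΞ₀]
  rw [← ha]
  -- All directions are constant vectors, so ∂_η moves from the front of the list to its end and
  -- acts on `actFun` first.
  have h4 : dirD ((1 : ℝ), (0 : Z × (Fin p → ℝ))) g =
      dirDs (L.map (yDir Z)) (dirD ((1 : ℝ), (0 : Z × (Fin p → ℝ))) (actFun Ξ Ψ T)) := by
    have h := dirDs_perm hW (List.perm_append_singleton ((1 : ℝ), (0 : Z × (Fin p → ℝ)))
      (L.map (yDir Z))).symm
    rw [dirDs_cons, dirDs_append] at h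
    exact h
  -- Derivatives tangent to the slice η = 0 see only the restriction of `actFun` to it, which is
  -- `T`.
  have h5 : dirD ((0 : ℝ), ((0 : Z), a)) g (0, (z, A z)) =
      ∑ i, a i • partialDs (i :: L) (fun y => T (z, y)) (A z) := by
    have h := map_eq_sum_single ((fderiv ℝ g (0, (z, A z))).comp
      ((ContinuousLinearMap.inr ℝ ℝ (Z × (Fin p → ℝ))).comp
        (ContinuousLinearMap.inr ℝ Z (Fin p → ℝ)))) a
    refine h.trans (Finset.sum_congr rfl fun i _ => congrArg (a i • ·) ?_)
    have h := dirDs_yDir hW (i :: L) z (A z)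
    simp only [actFun_zero hΞ₀ hΨ₀] at h
    exact h
  rw [h4, h5, dirDs_yDir (contDiff_dirD hW _)]
  have h6 : partialDs L (fun y => dirD ((1 : ℝ), (0 : Z × (Fin p → ℝ))) (actFun Ξ Ψ T)
      (0, (z, y))) (A z) α = partialDs L (charAlong (fun i y => dirD (1, 0) Ξ (0, y) i)
        (fun v => dirD (1, 0) Ψ (0, v) α) α fun y => T (z, y)) (A z) := by
    have hs : ContDiff ℝ ∞ fun y => dirD ((1 : ℝ), (0 : Z × (Fin p → ℝ))) (actFun Ξ Ψ T)
        (0, (z, y)) := (contDiff_dirD hW _).comp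
      (contDiff_const.prodMk (contDiff_const.prodMk contDiff_id))
    have h := congrFun (dirDs_clm hs (ContinuousLinearMap.proj (R := ℝ)
      (φ := fun _ : Fin q => ℝ) α) (L.map fun i => Pi.single i 1)) (A z)
    simp only [ContinuousLinearMap.proj_apply, dirD_actFun hΞ hΨ hT hΞ₀ hΨ₀] at h
    exact h.symm
  rw [Pi.add_apply, h6]
  simp [coeffAlong, Finset.sum_apply, ha]

/-! ### The coefficient formula on the jet space. -/

/-- The coefficient along a function with multi-index in place of a tuple. -/
theorem coeffAlong_perm {ξ : Fin p → (Fin p → ℝ) → ℝ} (hξ : ∀ i, ContDiff ℝ ∞ (ξ i))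
    {ψ : (Fin p → ℝ) × (Fin q → ℝ) → ℝ} (hψ : ContDiff ℝ ∞ ψ) (α : Fin q)
    {h : (Fin p → ℝ) → Fin q → ℝ} (hh : ContDiff ℝ ∞ h) {J J' : List (Fin p)} (hJ : J.Perm J') :
    coeffAlong ξ ψ α J h = coeffAlong ξ ψ α J' h := by
  have hc : ContDiff ℝ ∞ (charAlong ξ ψ α h) :=
    (hψ.comp (contDiff_id.prodMk hh)).sub (ContDiff.sum fun i _ => (hξ i).mul
      (contDiff_pi.1 (contDiff_partialDs hh _) α))
  ext1 x
  simp only [coeffAlong, partialDs_perm hc hJ, partialDs_perm hh (hJ.cons _)]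

theorem coeffAlong_nil (ξ : Fin p → (Fin p → ℝ) → ℝ) (ψ : (Fin p → ℝ) × (Fin q → ℝ) → ℝ)
    (α : Fin q) (h : (Fin p → ℝ) → Fin q → ℝ) (x : Fin p → ℝ) :
    coeffAlong ξ ψ α [] h x = ψ (x, h x) := sub_add_cancel _ _

/-- The characteristic as a function of `1`-jets. -/
def charFun (ξ : Fin p → (Fin p → ℝ) → ℝ) (ψ : (Fin p → ℝ) × (Fin q → ℝ) → ℝ) (α : Fin q)
    (w : Jet p q 1) : ℝ :=
  ψ (jetXU p q 1 w) - ∑ i, ξ i (jetX p q 1 w) * jetU p q (MultiIdx.ofList [i] le_rfl) α w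

/-- The expression `D_J(ψ_α - ∑ ξ_i u_i^α) + ∑ ξ_i u_{J,i}^α` for smooth functions. -/
def prolongCoeffFun (ξ : Fin p → (Fin p → ℝ) → ℝ) (ψ : (Fin p → ℝ) × (Fin q → ℝ) → ℝ)
    (α : Fin q) (J : List (Fin p)) (w : Jet p q (1 + J.length)) : ℝ :=
  totalDListFun 1 J (charFun ξ ψ α) w + ∑ i, ξ i (jetX p q (1 + J.length) w) *
    jetU p q (MultiIdx.ofList (i :: J) (by simp [add_comm])) α w

/-- Along the jets of h, the total derivatives turn into partial derivatives and the characteristic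
into `charAlong`. Thus the formula of the theorem is compared with the η-derivative of the action on
functions. -/
theorem prolongCoeffFun_jetOf {ξ : Fin p → (Fin p → ℝ) → ℝ} (hξ : ∀ i, ContDiff ℝ ∞ (ξ i))
    {ψ : (Fin p → ℝ) × (Fin q → ℝ) → ℝ} (hψ : ContDiff ℝ ∞ ψ) (α : Fin q)
    {h : (Fin p → ℝ) → Fin q → ℝ} (hh : ContDiff ℝ ∞ h) (J : List (Fin p)) (x : Fin p → ℝ) :
    prolongCoeffFun ξ ψ α J (jetOf (1 + J.length) h x) = coeffAlong ξ ψ α J h x := by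
  have hc : ContDiff ℝ ∞ (charFun ξ ψ α) :=
    (hψ.comp (jetXU p q 1).contDiff).sub (ContDiff.sum fun i _ =>
      ((hξ i).comp (jetX p q 1).contDiff).mul (jetU p q _ α).contDiff)
  have hu : ∀ (k : ℕ) (L : List (Fin p)) (hL : L.length ≤ k) y,
      jetU p q (MultiIdx.ofList L hL) α (jetOf k h y) = partialDs L h y α := fun k L hL y =>
    congrFun (jetOf_ofList hh L hL y) α
  have e1 : (fun y => charFun ξ ψ α (jetOf 1 h y)) = charAlong ξ ψ α h := by
    ext1 y
    have e : jetXU p q 1 (jetOf 1 h y) = (y, h y) := Prod.ext rfl (jetOf_zero hh y)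
    rw [charFun, charAlong, e]
    exact congrArg (ψ (y, h y) - ·)
      (Finset.sum_congr rfl fun i _ => congrArg (ξ i y * ·) (hu 1 [i] le_rfl y))
  rw [prolongCoeffFun, totalDListFun_jetOf hh J hc, e1, coeffAlong]
  simp only [hu]
  rfl

/-- The coefficients `D_J(ψ_α - ∑ ξ_i u_i^α) + ∑ ξ_i u_{J,i}^α`, `|J| ≤ n`, only depend on the
`n`-jet, and may be computed along its Taylor polynomial. -/
theorem coeffAlong_taylorPoly {ξ : Fin p → (Fin p → ℝ) → ℝ} (hξ : ∀ i, ContDiff ℝ ∞ (ξ i))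
    {ψ : (Fin p → ℝ) × (Fin q → ℝ) → ℝ} (hψ : ContDiff ℝ ∞ ψ) (α : Fin q) {n : ℕ}
    (J : List (Fin p)) (hJ : J.length ≤ n) (hJ' : 1 + J.length ≤ n + 1) (w : Jet p q (n + 1)) :
    coeffAlong ξ ψ α J (fun y => taylorPoly p q n (jetForget p q n.le_succ w, y)) w.1 =
      prolongCoeffFun ξ ψ α J (jetForget p q hJ' w) := by
  have hT : ∀ (m : ℕ) (z : Jet p q m), ContDiff ℝ ∞ fun y => taylorPoly p q m (z, y) :=
    fun m z => contDiff_slice (taylorPoly_hasTemperateGrowth p q m).1 z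
  -- One `G` serves all functions h. The Taylor polynomials of w and of its truncation to order n
  -- have the same |J|-jet at the base point since |J| ≤ n, so `G` takes the same value on both.
  obtain ⟨G, -, H⟩ := exists_coeffAlong_eq hξ hψ α J
  have e1 : jetForget p q hJ' w =
      jetOf (1 + J.length) (fun y => taylorPoly p q (n + 1) (w, y)) w.1 := by
    rw [← jetForget_jetOf hJ', jetOf_taylorPoly]
  have e2 := jetForget_jetOf hJ
    (fun y => taylorPoly p q n (jetForget p q n.le_succ w, y)) w.1
  have e3 := jetOf_taylorPoly (jetForget p q n.le_succ w)
  have e4 := jetForget_jetOf (hJ.trans n.le_succ) (fun y => taylorPoly p q (n + 1) (w, y)) w.1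
  rw [e1, prolongCoeffFun_jetOf hξ hψ α (hT _ _), H _ (hT _ _), H _ (hT _ _), ← e4,
    jetOf_taylorPoly, ← e2]
  exact congrArg (fun z => G (jetForget p q hJ z)) e3

end Flow

/-! ### Representatives of the prolonged action and of the vector fields. -/

section ProlongationRepresentatives

variable {p q : ℕ}

namespace Rep

/-- The fold over `List.finRange p` and `multiList` take the directions in the same order, so no
derivatives need to be interchanged here. -/
theorem partialY {Z F : Type} [NormedAddCommGroup Z] [NormedSpace ℝ Z] [NormedAddCommGroup F]
    [NormedSpace ℝ F] {W : GMixed ℝ (Z × (Fin p → ℝ)) F} {w : Eps → ℝ × (Z × (Fin p → ℝ)) → F}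
    (hw : Rep W w) (J : Fin p → ℕ) :
    Rep (Colombeau.partialY J W) (fun ε => dirDs ((multiList J).map (yDir Z)) (w ε)) := by
  have iter : ∀ (i : Fin p) (k : ℕ) {V : GMixed ℝ (Z × (Fin p → ℝ)) F}
      {v : Eps → ℝ × (Z × (Fin p → ℝ)) → F}, Rep V v → Rep ((GMixed.dirDeriv (yDir Z i))^[k] V)
        (fun ε => dirDs (List.replicate k (yDir Z i)) (v ε)) := by
    intro i k V v hv
    induction k with
    | zero => exact hv
    | succ k ih =>
      rw [Function.iterate_succ_apply']
      exact ih.dirDeriv _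
  unfold Colombeau.partialY multiList
  induction List.finRange p with
  | nil => exact hw
  | cons i l ih =>
    simp only [List.foldr_cons, List.flatMap_cons, List.map_append, dirDs_append,
      List.map_replicate]
    exact iter i (J i) ih

theorem totalD {k : ℕ} (i : Fin p) {f : GTau (Jet p q k) ℝ} {u : Eps → R0 × Jet p q k → ℝ}
    (hu : Rep f u) : Rep (Colombeau.totalD k i f)
      (fun ε x => totalDFun k i (fun z => u ε (0, z)) x.2) :=
  ((hu.gtauDirDeriv _).pull _).add (sum _ fun β => sum _ fun J =>
    (ofLin (jetU p q (J.succ i) β)).mul ((hu.gtauDirDeriv _).pull _))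

theorem totalDList {k : ℕ} (J : List (Fin p)) {f : GTau (Jet p q k) ℝ}
    {u : Eps → R0 × Jet p q k → ℝ} (hu : Rep f u) : Rep (Colombeau.totalDList k J f)
      (fun ε x => totalDListFun k J (fun z => u ε (0, z)) x.2) := by
  induction J with
  | nil =>
    refine hu.congr fun ε s y => ?_
    rw [Subsingleton.elim s 0]
    rfl
  | cons i J ih => exact totalD i ih

variable {ξ : Fin p → GTau (Fin p → ℝ) ℝ} {ψ : Fin q → GTau ((Fin p → ℝ) × (Fin q → ℝ)) ℝ}
  {a : Fin p → Eps → R0 × (Fin p → ℝ) → ℝ}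
  {b : Fin q → Eps → R0 × ((Fin p → ℝ) × (Fin q → ℝ)) → ℝ}

theorem prolongCoeff (hξ : ∀ i, Rep (ξ i) (a i)) (hψ : ∀ α, Rep (ψ α) (b α)) (α : Fin q)
    (J : List (Fin p)) : Rep (Colombeau.prolongCoeff ξ ψ α J) (fun ε x =>
      prolongCoeffFun (fun i y => a i ε (0, y)) (fun v => b α ε (0, v)) α J x.2) :=
  (totalDList J (((hψ α).pull _).sub (sum _ fun i => ((hξ i).pull _).mul (ofLin _)))).add
    (sum _ fun i => ((hξ i).pull _).mul (ofLin _))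

theorem pointField (hξ : ∀ i, Rep (ξ i) (a i)) (hψ : ∀ α, Rep (ψ α) (b α)) :
    Rep (Colombeau.pointField ξ ψ)
      (fun ε x => (fun i => a i ε (0, x.2.1), fun α => b α ε (0, x.2))) :=
  ((sum _ fun i => ((hξ i).pull _).vec _).add (sum _ fun α => (hψ α).vec _)).congr
    fun ε s y => by
      rw [Subsingleton.elim s 0]
      refine Prod.ext ?_ ?_
      · ext j
        simp [Prod.fst_sum, Finset.sum_apply, Pi.single_apply]
      · ext j
        simp [Prod.snd_sum, Finset.sum_apply, Pi.single_apply]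

/-- At the empty multi-index only the ψ-sum contributes and at all others only the c-sum; hence the
value of `c` at the empty multi-index is irrelevant. -/
theorem jetField {n : ℕ} {c : Fin q → MultiIdx p n → GTau (Jet p q n) ℝ}
    {d : Fin q → MultiIdx p n → Eps → R0 × Jet p q n → ℝ} (hξ : ∀ i, Rep (ξ i) (a i))
    (hψ : ∀ α, Rep (ψ α) (b α)) (hc : ∀ α J, Rep (c α J) (d α J)) :
    Rep (Colombeau.jetField n ξ ψ c) (fun ε x => (fun i => a i ε (0, x.2.1),
      fun J α => if J = MultiIdx.zero p n then b α ε (0, jetXU p q n x.2) else d α J ε x)) :=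
  (((sum _ fun i => ((hξ i).pull _).vec _).add (sum _ fun α => ((hψ α).pull _).vec _)).add
    (sum _ fun α => sum _ fun J => (hc α J).vec _)).congr fun ε s y => by
      refine Prod.ext ?_ ?_
      · ext j
        simp [Prod.fst_sum, Finset.sum_apply, Pi.single_apply, jetDx, jetDu, jetX]
      · ext J α
        by_cases hJ : J = MultiIdx.zero p n
        · simp [Prod.snd_sum, Finset.sum_apply, Pi.single_apply, jetDx, jetDu, hJ]
        · simp [Prod.snd_sum, Finset.sum_apply, Pi.single_apply, jetDx, jetDu, hJ]

variable {Φ : ProjAction p q} {Ξ : Eps → ℝ × (Fin p → ℝ) → Fin p → ℝ}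
  {Ψ : Eps → ℝ × ((Fin p → ℝ) × (Fin q → ℝ)) → Fin q → ℝ}

theorem action (hΞ : Rep Φ.Ξ Ξ) (hΨ : Rep Φ.Ψ Ψ) :
    Rep Φ.action (fun ε x => (Ξ ε (x.1, x.2.1), Ψ ε x)) :=
  (hΞ.insert (ofLin _)).pair hΨ

theorem prolong (hΞ : Rep Φ.Ξ Ξ) (hΨ : Rep Φ.Ψ Ψ) (n : ℕ) :
    Rep (Φ.prolong n) (fun ε x => (Ξ ε (x.1, x.2.1), fun J : MultiIdx p n =>
      dirDs ((multiList J.1).map (yDir (Jet p q n))) (actFun (Ξ ε) (Ψ ε) (taylorPoly p q n))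
        (x.1, (x.2, Ξ ε (x.1, x.2.1))))) := by
  have hx := hΞ.insert (ofLin (P := ℝ) (jetX p q n))
  have hy : Rep _ _ := comp contDiff_neg hΞ
    (ofLin (P := ℝ) (ContinuousLinearMap.snd ℝ (Jet p q n) (Fin p → ℝ)))
  have hW := hΨ.insert (hy.pair (gtauComp (ofSlow (taylorPoly_hasTemperateGrowth p q n))
    ((ofLin (ContinuousLinearMap.fst ℝ _ _)).pair hy)))
  exact hx.pair (tuple fun J : MultiIdx p n => (hW.partialY J.1).insert (proj.pair hx))

end Rep

/-- Representatives of `Ξ` and `Ψ` which are the identity at `η = 0` exactly. -/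
theorem ProjAction.exists_rep (Φ : ProjAction p q) : ∃ Ξ Ψ, Rep Φ.Ξ Ξ ∧ Rep Φ.Ψ Ψ ∧
    (∀ ε x, Ξ ε (0, x) = x) ∧ ∀ ε v, Ψ ε (0, v) = v.2 := by
  obtain ⟨Ξ, hΞ⟩ := Colombeau.exists_rep Φ.Ξ
  obtain ⟨Ψ, hΨ⟩ := Colombeau.exists_rep Φ.Ψ
  have h := (Rep.action hΞ hΨ).atParam 0
  have h0 : Φ.action.atParam 0 = proj R0 _ := Φ.isGroupAction.zero
  rw [h0] at h
  -- Ξ does not involve u, so it is recovered from the action by restricting to u = 0 and projecting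
  -- to x.
  have h1 : Φ.Ξ.atParam 0 = ofLin R0 (ContinuousLinearMap.id ℝ _) :=
    (((hΞ.atParam 0).congr fun _ _ _ => rfl).unique ((h.pull (ContinuousLinearMap.inl ℝ _ _)).lin
      (ContinuousLinearMap.fst ℝ _ _))).trans (((Rep.proj.pull _).lin _).unique
        ((Rep.ofLin _).congr fun _ _ _ => rfl))
  have h2 : Φ.Ψ.atParam 0 = ofLin R0 (ContinuousLinearMap.snd ℝ _ _) :=
    (((hΨ.atParam 0).congr fun _ _ _ => rfl).unique (h.lin (ContinuousLinearMap.snd ℝ _ _))).trans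
      ((Rep.proj.lin _).unique ((Rep.ofLin _).congr fun _ _ _ => rfl))
  obtain ⟨Ξ', hΞ', hΞ₀⟩ := exists_rep_of_atParam_zero h1
  obtain ⟨Ψ', hΨ', hΨ₀⟩ := exists_rep_of_atParam_zero h2
  exact ⟨Ξ', Ψ', hΞ', hΨ', hΞ₀, hΨ₀⟩

/-- The coefficients of the generator of a projectable action are the `η`-derivatives at `0`. -/
theorem rep_of_generator {Φ : ProjAction p q} {ξ : Fin p → GTau (Fin p → ℝ) ℝ}
    {ψ : Fin q → GTau ((Fin p → ℝ) × (Fin q → ℝ)) ℝ}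
    (hX : generator Φ.action = pointField ξ ψ) {Ξ : Eps → ℝ × (Fin p → ℝ) → Fin p → ℝ}
    {Ψ : Eps → ℝ × ((Fin p → ℝ) × (Fin q → ℝ)) → Fin q → ℝ} (hΞ : Rep Φ.Ξ Ξ)
    (hΨ : Rep Φ.Ψ Ψ) :
    (∀ i, Rep (ξ i) fun ε x => dirD ((1 : ℝ), (0 : Fin p → ℝ)) (Ξ ε) (0, x.2) i) ∧
      ∀ α, Rep (ψ α) fun ε x =>
        dirD ((1 : ℝ), (0 : (Fin p → ℝ) × (Fin q → ℝ))) (Ψ ε) (0, x.2) α := by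
  choose a ha using fun i => exists_rep (ξ i)
  choose b hb using fun α => exists_rep (ψ α)
  have h1 := (Rep.action hΞ hΨ).generator
  rw [hX] at h1
  have h2 := Rep.pointField ha hb
  have hs := fun ε => (Rep.action hΞ hΨ).contDiff ε
  constructor
  · intro i
    let A : (Fin p → ℝ) × (Fin q → ℝ) →L[ℝ] ℝ :=
      (ContinuousLinearMap.proj i).comp (ContinuousLinearMap.fst ℝ _ _)
    let B := ContinuousLinearMap.inl ℝ (Fin p → ℝ) (Fin q → ℝ)
    -- The x-coefficients of the field are constant in u, so restricting to u = 0 loses nothing.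
    -- This expresses `ξ i` through the generator, for which the η-derivatives are a representative.
    have e : ξ i = GMixed.lin A (GTau.pull B (pointField ξ ψ)) :=
      (ha i).unique (((h2.pull B).lin A).congr fun ε s y => by rw [Subsingleton.elim s 0]; rfl)
    rw [e]
    refine ((h1.pull B).lin A).congr fun ε s y => ?_
    have h3 := congrFun (dirD_clm (hs ε) (ContinuousLinearMap.fst ℝ _ _)
      ((1 : ℝ), (0 : (Fin p → ℝ) × (Fin q → ℝ)))) (0, (y, 0))
    have h4 := hasDerivAt_fst (hΞ.contDiff ε) 0 y
    have h5 := hasDerivAt_fst ((ContinuousLinearMap.fst ℝ _ _).contDiff.comp (hs ε)) 0 (y, 0)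
    -- Both derivatives belong to the same curve η ↦ Ξ_ε(η, y).
    exact congrFun (h3.symm.trans (h5.unique h4)) i
  · intro α
    let A : (Fin p → ℝ) × (Fin q → ℝ) →L[ℝ] ℝ :=
      (ContinuousLinearMap.proj α).comp (ContinuousLinearMap.snd ℝ _ _)
    have e : ψ α = GMixed.lin A (pointField ξ ψ) :=
      (hb α).unique ((h2.lin A).congr fun ε s y => by rw [Subsingleton.elim s 0]; rfl)
    rw [e]
    refine (h1.lin A).congr fun ε s y => ?_
    exact congrFun (congrFun (dirD_clm (hs ε) (ContinuousLinearMap.snd ℝ _ _)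
      ((1 : ℝ), (0 : (Fin p → ℝ) × (Fin q → ℝ)))) (0, y)).symm α

end ProlongationRepresentatives

/-- The prolonged vector field, in terms of the `η`-derivatives of `Ξ` and `Ψ`. -/
theorem Rep.prolongedField {p q : ℕ} {Φ : ProjAction p q}
    {Ξ : Eps → ℝ × (Fin p → ℝ) → Fin p → ℝ}
    {Ψ : Eps → ℝ × ((Fin p → ℝ) × (Fin q → ℝ)) → Fin q → ℝ} (hΞ : Rep Φ.Ξ Ξ)
    (hΨ : Rep Φ.Ψ Ψ) (hΞ₀ : ∀ ε x, Ξ ε (0, x) = x) (hΨ₀ : ∀ ε v, Ψ ε (0, v) = v.2) (n : ℕ) :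
    Rep (Φ.prolongedField n) (fun ε x => (dirD ((1 : ℝ), (0 : Fin p → ℝ)) (Ξ ε) (0, x.2.1),
      fun J α => coeffAlong (fun i y => dirD (1, 0) (Ξ ε) (0, y) i)
        (fun v => dirD (1, 0) (Ψ ε) (0, v) α) α (multiList J.1)
        (fun y => taylorPoly p q n (x.2, y)) x.2.1)) := by
  have h := Rep.prolong hΞ hΨ n
  refine h.generator.congr fun ε s z => Prod.ext ?_ (funext fun J => funext fun α => ?_)
  · have h1 := congrFun (dirD_clm (h.contDiff ε) (ContinuousLinearMap.fst ℝ _ _)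
      ((1 : ℝ), (0 : Jet p q n))) (0, z)
    have h2 := hasDerivAt_fst ((ContinuousLinearMap.fst ℝ _ _).contDiff.comp (h.contDiff ε)) 0 z
    exact h1.symm.trans (h2.unique (hasDerivAt_fst (hΞ.contDiff ε) 0 z.1))
  · have h1 := congrFun (dirD_clm (h.contDiff ε) ((ContinuousLinearMap.proj (R := ℝ)
      (φ := fun _ : MultiIdx p n => Fin q → ℝ) J).comp (ContinuousLinearMap.snd ℝ _ _))
        ((1 : ℝ), (0 : Jet p q n))) (0, z)
    exact (congrFun h1 α).symm.trans (dirD_prolong (hΞ.contDiff ε) (hΨ.contDiff ε)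
      (taylorPoly_hasTemperateGrowth p q n).1 (hΞ₀ ε) (hΨ₀ ε) (jetX p q n) _ z α)

end Colombeau
end

/-! ### The prolongation formula. -/

theorem theorem4p17 (p q n : ℕ)
    (ξ : Fin p → GTau (Fin p → ℝ) ℝ)
    (ψ : Fin q → GTau ((Fin p → ℝ) × (Fin q → ℝ)) ℝ)
    (Φ : ProjAction p q)
    (hX : IsGNComplete n (pointField ξ ψ) Φ) :
    ∃ c : Fin q → MultiIdx p n → GTau (Jet p q n) ℝ,
      (∀ (α : Fin q) (J : List (Fin p)) (_ : 1 ≤ J.length) (hJ : J.length ≤ n),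
        GTau.pull (jetForget p q n.le_succ) (c α (MultiIdx.ofList J hJ)) =
          GTau.pull (jetForget p q (show 1 + J.length ≤ n + 1 by omega))
            (prolongCoeff ξ ψ α J)) ∧
      Φ.prolongedField n = jetField n ξ ψ c := by
  obtain ⟨Ξ, Ψ, hΞ, hΨ, hΞ₀, hΨ₀⟩ := Φ.exists_rep
  obtain ⟨hξ, hψ⟩ := rep_of_generator hX.generates hΞ hΨ
  have hpr := Rep.prolongedField hΞ hΨ hΞ₀ hΨ₀ n
  -- The coefficients c are the u_J^α-components of the prolonged field itself, so they are tempered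
  -- generalized functions of n-jets by construction.
  have hc := fun α (J : MultiIdx p n) => hpr.lin (jetU p q J α)
  have sξ : ∀ ε i, ContDiff ℝ ∞ fun y => dirD ((1 : ℝ), (0 : Fin p → ℝ)) (Ξ ε) (0, y) i :=
    fun ε i => ((hξ i).contDiff ε).comp
      ((contDiff_const (c := (0 : R0))).prodMk contDiff_id)
  have sψ : ∀ ε α, ContDiff ℝ ∞ fun v =>
      dirD ((1 : ℝ), (0 : (Fin p → ℝ) × (Fin q → ℝ))) (Ψ ε) (0, v) α :=
    fun ε α => ((hψ α).contDiff ε).comp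
      ((contDiff_const (c := (0 : R0))).prodMk contDiff_id)
  have sT : ∀ z : Jet p q n, ContDiff ℝ ∞ fun y => taylorPoly p q n (z, y) :=
    contDiff_slice (taylorPoly_hasTemperateGrowth p q n).1
  refine ⟨_, fun α J _ hJ => ?_, hpr.unique ((Rep.jetField hξ hψ hc).congr fun ε s z => ?_)⟩
  · refine (((hc α (MultiIdx.ofList J hJ)).pull _).congr fun ε s w => ?_).unique
      ((Rep.prolongCoeff hξ hψ α J).pull _)
    rw [← coeffAlong_taylorPoly (sξ ε) (sψ ε α) α J hJ (by omega) w]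
    -- The component was computed with the ordered tuple of the multi-index of J, the formula with J
    -- itself; the two are permutations of each other.
    exact congrFun (coeffAlong_perm (sξ ε) (sψ ε α) α (sT _) (multiList_perm fun _ => rfl)) w.1
  · refine Prod.ext rfl (funext fun J => funext fun α => ?_)
    dsimp only
    split_ifs with h
    · subst h
      -- For the empty tuple the ξ-terms cancel, and ψ_α(x, h_z(x)) = ψ_α(x, u) is left because the
      -- Taylor polynomial has the value u at x.
      rw [coeffAlong_perm (sξ ε) (sψ ε α) α (sT _) (multiList_perm (J := (MultiIdx.zero p n).1)
        (L := []) fun _ => rfl),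
        coeffAlong_nil]
      have e := jetOf_zero (sT z) (k := n) z.1
      rw [jetOf_taylorPoly] at e
      rw [← e]
      rfl
    · rfl
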